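/- **Corollary 2.6.** Let $\mathcal H$ be a complex Hilbert space, let $\mathcal A\subseteq B(\mathcal H)$ be an abelian von Neumann algebra, and let $\tau:\mathcal A\to\mathcal A$ be a normal unital completely positive map. A *minimal dilation* of $\tau$ is a triple $(\mathcal K,\mathcal B,\theta)$ consisting of a Hilbert space $\mathcal K\supseteq\mathcal H$, a von Neumann algebra $\mathcal B\subseteq B(\mathcal K)$ and a normal unital $*$-endomorphism $\theta:\mathcal B\to\mathcal B$ such that, with $p$ the orthogonal projection of $\mathcal K$ onto $\mathcal H$ and with $x\in B(\mathcal H)$ identified with $pxp\in B(\mathcal K)$, * $\mathcal A\subseteq\mathcal B$ and $\mathcal A=p\mathcal Bp$; * $\tau^n(x)=p\,\theta^n(x)\,p$ for all $x\in\mathcal A$, $n\ge 0$; * $\mathcal K=\overline{\operatorname{span}}\{\theta^n(x_n)\cdots\theta(x_1)h:\ n\ge 0,\ x_1,\dots,x_n\in\mathcal A,\ h\in\mathcal H\}$; * $\mathcal B$ is the von Neumann algebra generated by $\{\theta^n(x): n\ge 0,\ x\in\mathcal A\}$. For $\varphi\in\{\tau,\theta\}$ let $\mathcal P(\varphi)$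 be the norm closure of the linear span of all $x$ in the domain of $\varphi$ with $\varphi(x)=\lambda x$ for some $\lambda\in\mathbb C$, $|\lambda|=1$; $\mathcal P(\theta)$ is a unital $C^*$-subalgebra of $\mathcal B$. Then the peripheral Poisson boundary of $\tau$ is abelian. That is: a minimal dilation of $\tau$ exists, and for every minimal dilation $(\mathcal K,\mathcal B,\theta)$ of $\tau$ the compression $T:z\mapsto pzp$ is a linear isometry of $\mathcal P(\theta)$ onto $\mathcal P(\tau)$, and the product $x\circ y:=T\big(T^{-1}(x)\,T^{-1}(y)\big)$, which makes $\mathcal P(\tau)$ into the $C^*$-algebra called the peripheral Poisson boundary of $\tau$, satisfies $x\circ y=y\circ x$ for all $x,y\in\mathcal P(\tau)$. -/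

import Mathlib

open scoped CStarAlgebra InnerProductSpace

universe u v

noncomputable section

/-! ### A von Neumann algebra on a Hilbert space as an ordered C⋆-algebra -/

section VonNeumann

variable {H : Type u} [NormedAddCommGroup H] [InnerProductSpace ℂ H] [CompleteSpace H]

instance VonNeumannAlgebra.instSMulMemClassComplex :
    SMulMemClass (VonNeumannAlgebra H) ℂ (H →L[ℂ] H) where
  smul_mem {s} c _ hx := s.toStarSubalgebra.smul_mem hx c

/-- A von Neumann algebra is norm closed. With this instance Mathlib turns its type of elements
into a C⋆-algebra, with the operations and the norm of `H →L[ℂ] H`. -/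
instance VonNeumannAlgebra.instIsClosedCoe (A : VonNeumannAlgebra H) :
    IsClosed (A : Set (H →L[ℂ] H)) := by
  rw [← A.centralizer_centralizer]
  exact Set.isClosed_centralizer _

/-- The order on the elements of a von Neumann algebra is the Loewner order of `H →L[ℂ] H`; this
instance says that it is the order of the C⋆-algebra. -/
instance VonNeumannAlgebra.instStarOrderedRingCoe (A : VonNeumannAlgebra H) :
    StarOrderedRing A := by
  refine StarOrderedRing.of_nonneg_iff' (fun {x y} h z => ?_) (fun x => ⟨fun hx => ?_, ?_⟩)
  · exact add_le_add_right (α := H →L[ℂ] H) h z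
  · have hx' : (0 : H →L[ℂ] H) ≤ x := hx
    have hs : CFC.sqrt (x : H →L[ℂ] H) ∈ A := by
      rw [CFC.sqrt_eq_real_sqrt (x : H →L[ℂ] H) hx']
      exact cfcₙ_mem (𝕜' := ℂ) Real.sqrt x.2
    refine ⟨⟨_, hs⟩, Subtype.ext ?_⟩
    change (x : H →L[ℂ] H) = star (CFC.sqrt (x : H →L[ℂ] H)) * CFC.sqrt (x : H →L[ℂ] H)
    rw [(CFC.sqrt_nonneg (x : H →L[ℂ] H)).isSelfAdjoint.star_eq,
      CFC.sqrt_mul_sqrt_self (x : H →L[ℂ] H) hx']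
  · rintro ⟨s, rfl⟩
    exact star_mul_self_nonneg (s : H →L[ℂ] H)

/-- A normal unital completely positive map of a von Neumann algebra. Normality (preservation of
the least upper bounds of bounded increasing nets) is Mathlib's `ScottContinuous`. -/
structure IsNormalUCP {A : VonNeumannAlgebra H} (τ : A →CP A) : Prop where
  map_one : τ 1 = 1
  normal : ScottContinuous τ

end VonNeumann

/-! ### The norm closed span of the peripheral eigenvectors -/

section Peripheral

variable {M : Type u} [CStarAlgebra M]

/-- The eigenvectors of `φ`, together with `0`, for eigenvalues of modulus one. -/
def peripheralEigenvectors (φ : M →ₗ[ℂ] M) : Set M :=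
  {x | ∃ c : ℂ, ‖c‖ = 1 ∧ φ x = c • x}

/-- The space `𝒫(φ)`: the norm closure of the linear span of the peripheral eigenvectors. -/
def peripheralSpace (φ : M →ₗ[ℂ] M) : Submodule ℂ M :=
  (Submodule.span ℂ (peripheralEigenvectors φ)).topologicalClosure

/-- The linear map underlying a star-endomorphism. -/
abbrev endoLinear (θ : M →⋆ₐ[ℂ] M) : M →ₗ[ℂ] M := θ.toAlgHom.toLinearMap

/-- If `θ` is a unital star-endomorphism then the linear span of its peripheral eigenvectors is a
unital star-subalgebra. -/
def peripheralSpanAlgebra (θ : M →⋆ₐ[ℂ] M) : StarSubalgebra ℂ M where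
  carrier := Submodule.span ℂ (peripheralEigenvectors (endoLinear θ))
  add_mem' := fun ha hb => Submodule.add_mem _ ha hb
  zero_mem' := Submodule.zero_mem _
  one_mem' := Submodule.subset_span ⟨1, by simp, by simp⟩
  algebraMap_mem' := fun r => by
    rw [Algebra.algebraMap_eq_smul_one]
    exact Submodule.smul_mem _ _ (Submodule.subset_span ⟨1, by simp, by simp⟩)
  mul_mem' := fun {a b} ha hb => by
    have h := Submodule.mul_mem_mul (R := ℂ) ha hb
    rw [Submodule.span_mul_span] at h
    refine Submodule.span_mono ?_ h
    rintro _ ⟨x, ⟨c, hc, hx⟩, y, ⟨d, hd, hy⟩, rfl⟩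
    refine ⟨c * d, by simp [hc, hd], ?_⟩
    have hx' : θ x = c • x := hx
    have hy' : θ y = d • y := hy
    change θ (x * y) = (c * d) • (x * y)
    rw [map_mul, hx', hy', smul_mul_smul_comm]
  star_mem' := fun {a} ha => by
    change star a ∈ Submodule.span ℂ (peripheralEigenvectors (endoLinear θ))
    induction ha using Submodule.span_induction with
    | mem x hx =>
      obtain ⟨c, hc, hx⟩ := hx
      refine Submodule.subset_span ⟨star c, by simp [hc], ?_⟩
      have hx' : θ x = c • x := hx
      change θ (star x) = star c • star x
      rw [map_star, hx', star_smul]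
    | zero => simp
    | add x y _ _ hx hy => rw [star_add]; exact Submodule.add_mem _ hx hy
    | smul r x _ hx => rw [star_smul]; exact Submodule.smul_mem _ _ hx

/-- The C⋆-algebra `𝒫(θ)` of a unital star-endomorphism `θ`: its elements are those of
`peripheralSpace`. -/
def peripheralAlgebra (θ : M →⋆ₐ[ℂ] M) : StarSubalgebra ℂ M :=
  (peripheralSpanAlgebra θ).topologicalClosure

theorem coe_peripheralAlgebra (θ : M →⋆ₐ[ℂ] M) :
    (peripheralAlgebra θ : Set M) = peripheralSpace (endoLinear θ) := rfl

end Peripheral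

/-! ### The minimal dilation -/

section Dilation

variable {H : Type u} [NormedAddCommGroup H] [InnerProductSpace ℂ H] [CompleteSpace H]
  {K : Type v} [NormedAddCommGroup K] [InnerProductSpace ℂ K] [CompleteSpace K]

/-- The operator `x` on `H`, regarded as an operator on the larger space `K ⊇ H` that vanishes on
the orthogonal complement of `H`. The inclusion of `H` into `K` is the isometry `V`, so that the
orthogonal projection `p` of `K` onto `H` is `inflate V 1`. -/
def inflate (V : H →ₗᵢ[ℂ] K) (x : H →L[ℂ] H) : K →L[ℂ] K :=
  V.toContinuousLinearMap ∘L x ∘L V.toContinuousLinearMap.adjoint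

/-- The compression `p z p` of an operator `z` on `K`, as an operator on `H`. -/
def compress (V : H →ₗᵢ[ℂ] K) (z : K →L[ℂ] K) : H →L[ℂ] H :=
  V.toContinuousLinearMap.adjoint ∘L z ∘L V.toContinuousLinearMap

/-- The vector `θⁿ(xₙ) θⁿ⁻¹(xₙ₋₁) ⋯ θ(x₁) h`, where `ι` is the inclusion of `A` into `B`. -/
def dilationWord {A : VonNeumannAlgebra H} {B : VonNeumannAlgebra K} (V : H →ₗᵢ[ℂ] K)
    (θ : B →⋆ₐ[ℂ] B) (ι : A → B) (x : ℕ → A) (h : H) : ℕ → K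
  | 0 => V h
  | n + 1 => (θ^[n + 1] (ι (x (n + 1))) : K →L[ℂ] K) (dilationWord V θ ι x h n)

/-- `(K, B, θ)`, with `H` included in `K` by `V`, is the minimal dilation of `τ : A → A`. -/
structure IsMinimalDilation {A : VonNeumannAlgebra H} (τ : A →CP A) (V : H →ₗᵢ[ℂ] K)
    (B : VonNeumannAlgebra K) (θ : B →⋆ₐ[ℂ] B) : Prop where
  /-- `A ⊆ B` -/
  inflate_mem (a : A) : inflate V a ∈ B
  /-- `p B p ⊆ A` -/
  compress_mem (b : B) : compress V b ∈ A
  /-- the unital star-endomorphism `θ` is normal -/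
  normal : ScottContinuous θ
  /-- `τⁿ(a) = p θⁿ(a) p` -/
  dilation (n : ℕ) (a : A) :
    (τ^[n] a : H →L[ℂ] H) = compress V (θ^[n] ⟨inflate V a, inflate_mem a⟩ : B)
  /-- minimality of the space -/
  space_minimal :
    (Submodule.span ℂ {k : K | ∃ (n : ℕ) (x : ℕ → A) (h : H),
      k = dilationWord V θ (fun a => ⟨inflate V a, inflate_mem a⟩) x h n}).topologicalClosure = ⊤
  /-- minimality of the algebra: `B` is the von Neumann algebra generated by all `θⁿ(a)` -/
  algebra_minimal :
    IsLeast {C : VonNeumannAlgebra K | ∀ (n : ℕ) (a : A),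
      (θ^[n] ⟨inflate V a, inflate_mem a⟩ : K →L[ℂ] K) ∈ C} B

/-- The map `T` is the compression `z ↦ p z p` from `𝒫(θ)` to `𝒫(τ)`. -/
def IsCompression {A : VonNeumannAlgebra H} (τ : A →CP A) (V : H →ₗᵢ[ℂ] K)
    (B : VonNeumannAlgebra K) (θ : B →⋆ₐ[ℂ] B)
    (T : peripheralAlgebra θ ≃ₗᵢ[ℂ] peripheralSpace τ.toLinearMap) : Prop :=
  ∀ z : peripheralAlgebra θ, ((T z : A) : H →L[ℂ] H) = compress V ((z : B) : K →L[ℂ] K)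

/-- The product `x ∘ y = T (T⁻¹(x) T⁻¹(y))` of the peripheral Poisson boundary `𝒫(τ)`, for
`T : 𝒫(θ) → 𝒫(τ)` an isometric bijection. -/
def boundaryMul {A : VonNeumannAlgebra H} {τ : A →CP A} {B : VonNeumannAlgebra K}
    {θ : B →⋆ₐ[ℂ] B} (T : peripheralAlgebra θ ≃ₗᵢ[ℂ] peripheralSpace τ.toLinearMap)
    (x y : peripheralSpace τ.toLinearMap) : peripheralSpace τ.toLinearMap :=
  T (T.symm x * T.symm y)

end Dilation

end

/-! Existence. The inner products of the vectors θⁿ(xₙ)⋯θ(x₁)x₀h are forced: they come from the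
kernel x₀⋆τ(x₁⋆τ(⋯)y₁)y₀ on words. Complete positivity makes this kernel positive, and τ(1) = 1
allows words of different lengths to be compared after padding by 1. Its Kolmogorov decomposition
gives K and operators Γ x : H → K. Let B consist of the operators b with all (Γ x)⋆ b (Γ y) in A; it
is the commutant of a lift of A' to K (`mem_familyAlgebra_iff`), hence a von Neumann algebra. The
Stinespring dilation of b ↦ τ(pbp) represents B on a space L, and the recursion of the kernel embeds
K isometrically into L. Normality of τ makes this embedding onto
(`IsWordFamily.surjective_wordIsometry`), and the representation carried back to K is θ.

The boundary. In any minimal dilation the projections pₙ = θⁿ(p) increase strongly to 1, and pₙ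
θⁿ(w) pₙ = θⁿ(pwp). Eigenvalues of modulus one are invertible, so every z in the span of the
peripheral eigenvectors of θ is θⁿ(w) with w in the same span; hence pₙ z pₙ = θⁿ(pwp) comes from A.

The compression is isometric because θᵏ(w) returns to w along a filter on which all cᵏ with |c| = 1
tend to 1: this bounds ‖pwp‖, and so every ‖pₙ z pₙ‖, by ‖pzp‖. It is onto because an eigenvector
τ(x) = cx lifts to the strong limit of c⁻ⁿθⁿ(x). Finally zw is the strong limit of (pₙ z pₙ)(pₙ w
pₙ), a product of images under θⁿ of elements of A; if A is abelian these commute, and so do z and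
w. -/

set_option linter.unusedSectionVars false

noncomputable section

/-! ### Total families of operators and their kernels -/

section Kolmogorov

variable {X : Type*} {H : Type*} [NormedAddCommGroup H] [InnerProductSpace ℂ H] [CompleteSpace H]
  {K : Type*} [NormedAddCommGroup K] [InnerProductSpace ℂ K] [CompleteSpace K]
  {L : Type*} [NormedAddCommGroup L] [InnerProductSpace ℂ L] [CompleteSpace L]

/-- A family of operators `H → K` whose ranges together span a dense subspace of `K`. -/
def IsTotalFamily (Γ : X → H →L[ℂ] K) : Prop :=
  (Submodule.span ℂ {k : K | ∃ x h, Γ x h = k}).topologicalClosure = ⊤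

/-- A Hermitian operator-valued kernel all of whose quadratic forms are positive. -/
structure IsPosKernel (k : X → X → H →L[ℂ] H) : Prop where
  star_eq (x y : X) : star (k x y) = k y x
  nonneg (f : X →₀ H) : 0 ≤ (f.sum fun x v => f.sum fun y w => ⟪v, k x y w⟫_ℂ).re

/-- The operator `∑ x, Γ x` on finitely supported families of vectors. -/
def synthesis (Γ : X → H →L[ℂ] K) : (X →₀ H) →ₗ[ℂ] K :=
  Finsupp.lsum ℂ fun x => (Γ x : H →ₗ[ℂ] K)

theorem synthesis_apply (Γ : X → H →L[ℂ] K) (f : X →₀ H) :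
    synthesis Γ f = f.sum fun x v => Γ x v := rfl

theorem synthesis_single (Γ : X → H →L[ℂ] K) (x : X) (v : H) :
    synthesis Γ (Finsupp.single x v) = Γ x v := by
  simp [synthesis_apply]

theorem IsTotalFamily.denseRange {Γ : X → H →L[ℂ] K} (hΓ : IsTotalFamily Γ) :
    DenseRange (synthesis Γ) := by
  have h : Submodule.span ℂ {k : K | ∃ x h, Γ x h = k} ≤ LinearMap.range (synthesis Γ) := by
    rw [Submodule.span_le]
    rintro _ ⟨x, h, rfl⟩
    exact ⟨Finsupp.single x h, synthesis_single Γ x h⟩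
  have h2 := Submodule.topologicalClosure_mono h
  rw [hΓ, top_le_iff, ← Submodule.dense_iff_topologicalClosure_eq_top] at h2
  exact h2

theorem IsTotalFamily.ext {E : Type*} [NormedAddCommGroup E] [NormedSpace ℂ E]
    {Γ : X → H →L[ℂ] K} (hΓ : IsTotalFamily Γ) {S T : K →L[ℂ] E}
    (h : ∀ x v, S (Γ x v) = T (Γ x v)) : S = T := by
  refine ContinuousLinearMap.coeFn_injective
    (hΓ.denseRange.equalizer S.continuous T.continuous (funext fun f => ?_))
  simp [synthesis_apply, Finsupp.sum, h]

theorem IsTotalFamily.ext_inner {Γ : X → H →L[ℂ] K} (hΓ : IsTotalFamily Γ) {ξ η : K}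
    (h : ∀ x v, ⟪Γ x v, ξ⟫_ℂ = ⟪Γ x v, η⟫_ℂ) : ξ = η := by
  have : innerSL ℂ ξ = innerSL ℂ η := hΓ.ext fun x v => by
    simpa using congrArg star (h x v)
  exact ext_inner_right ℂ fun w => congrArg (fun T => T w) this

theorem inner_synthesis (Γ : X → H →L[ℂ] K) (f : X →₀ H) :
    ⟪synthesis Γ f, synthesis Γ f⟫_ℂ =
      f.sum fun x v => f.sum fun y w => ⟪v, ((Γ x).adjoint ∘L Γ y) w⟫_ℂ := by
  simp only [synthesis_apply, Finsupp.sum_inner, Finsupp.inner_sum, ContinuousLinearMap.comp_apply,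
    ContinuousLinearMap.adjoint_inner_right]
  exact Finsupp.sum_comm ..

theorem isPosKernel_adjoint_comp (Γ : X → H →L[ℂ] K) :
    IsPosKernel fun x y => (Γ x).adjoint ∘L Γ y where
  star_eq x y := by
    rw [ContinuousLinearMap.star_eq_adjoint, ContinuousLinearMap.adjoint_comp,
      ContinuousLinearMap.adjoint_adjoint]
  nonneg f := by
    rw [← inner_synthesis]
    exact inner_self_nonneg (𝕜 := ℂ)

/-- Two families with the same kernel, the first of which is total, are intertwined by an
isometry. -/
theorem IsTotalFamily.exists_isometry {Γ : X → H →L[ℂ] K} (hΓ : IsTotalFamily Γ)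
    (Λ : X → H →L[ℂ] L)
    (h : ∀ x y, (Λ x).adjoint ∘L Λ y = (Γ x).adjoint ∘L Γ y) :
    ∃ U : K →ₗᵢ[ℂ] L, ∀ x v, U (Γ x v) = Λ x v := by
  -- The kernel determines the norm of every finite sum.
  have hn : ∀ f, ‖synthesis Λ f‖ = ‖synthesis Γ f‖ := fun f => by
    rw [@norm_eq_sqrt_re_inner ℂ, @norm_eq_sqrt_re_inner ℂ _ _ _ _ (synthesis Γ f),
      inner_synthesis, inner_synthesis]
    simp only [h]
  have hb : ∃ C, ∀ f, ‖synthesis Λ f‖ ≤ C * ‖synthesis Γ f‖ := ⟨1, fun f => by rw [hn, one_mul]⟩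
  let U := (synthesis Λ).extendOfNorm (synthesis Γ)
  have hU : ∀ f, U (synthesis Γ f) = synthesis Λ f :=
    LinearMap.extendOfNorm_eq hΓ.denseRange hb
  refine ⟨⟨U, fun ξ => ?_⟩, fun x v => ?_⟩
  · refine hΓ.denseRange.induction_on (p := fun ξ => ‖U ξ‖ = ‖ξ‖) ξ
      (isClosed_eq (by fun_prop) (by fun_prop)) fun f => ?_
    rw [hU, hn]
  · simpa only [synthesis_single] using! hU (Finsupp.single x v)

/-- A family indexed by a C⋆-algebra on whose kernel the unitaries act isometrically is acted upon
by the whole algebra. -/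
theorem IsTotalFamily.exists_operator {M : Type*} [CStarAlgebra M] {Γ : X → H →L[ℂ] K}
    (hΓ : IsTotalFamily Γ) (π : M →ₗ[ℂ] X → H →L[ℂ] K)
    (h : ∀ m ∈ unitary M, ∀ x y, (π m x).adjoint ∘L π m y = (Γ x).adjoint ∘L Γ y) (m : M) :
    ∃ T : K →L[ℂ] K, ∀ x v, T (Γ x v) = π m x v := by
  have hm : m ∈ Submodule.span ℂ (unitary M : Set M) := by
    rw [CStarAlgebra.span_unitary]; trivial
  induction hm using Submodule.span_induction with
  | mem m hm =>
    obtain ⟨U, hU⟩ := hΓ.exists_isometry (π m) (h m hm)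
    exact ⟨U.toContinuousLinearMap, hU⟩
  | zero => exact ⟨0, by simp⟩
  | add a b _ _ ha hb =>
    obtain ⟨S, hS⟩ := ha
    obtain ⟨T, hT⟩ := hb
    exact ⟨S + T, fun x v => by simp [hS, hT]⟩
  | smul c a _ ha =>
    obtain ⟨S, hS⟩ := ha
    exact ⟨c • S, fun x v => by simp [hS]⟩

end Kolmogorov

section KolmogorovExists

open scoped ComplexOrder

variable {X : Type u} {H : Type u} [NormedAddCommGroup H] [InnerProductSpace ℂ H] [CompleteSpace H]

/-- The Kolmogorov decomposition of a positive kernel. -/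
theorem IsPosKernel.exists_family {k : X → X → H →L[ℂ] H} (hk : IsPosKernel k) :
    ∃ (K : Type u) (_ : NormedAddCommGroup K) (_ : InnerProductSpace ℂ K) (_ : CompleteSpace K)
      (Γ : X → H →L[ℂ] K), IsTotalFamily Γ ∧ ∀ x y, (Γ x).adjoint ∘L Γ y = k x y := by
  let M : Matrix X X (H →L[ℂ] H) := .of k
  have hM : M.PosSemidef := by
    have hM := (RKHS.posSemidef_tfae (K := M)).out 0 2
    refine hM.2 ⟨?_, fun f => ?_⟩
    · ext1 x y
      exact hk.star_eq y x
    · convert! hk.nonneg f using 1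
      rw [← RCLike.re_eq_complex_re, Finsupp.sum_comm]
      simp only [map_finsuppSum]
      exact Finsupp.sum_congr fun x _ => Finsupp.sum_congr fun y _ => inner_re_symm ..
  have : Fact M.PosSemidef := ⟨hM⟩
  -- The space is the reproducing kernel Hilbert space of `k`, with the kernel functions as the
  -- family.
  refine ⟨RKHS.OfKernel M, inferInstance, inferInstance, inferInstance,
    RKHS.kerFun (RKHS.OfKernel M), RKHS.kerFun_dense _, fun x y => ?_⟩
  rw [← RKHS.kernel_apply, RKHS.OfKernel.kernel_ofKernel]
  rfl

end KolmogorovExists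

/-! ### Positive matrices over a von Neumann algebra and positive kernels -/

section MatrixForm

theorem exists_eq_star_mul_self_of_nonneg {M : Type*} [CStarAlgebra M] [PartialOrder M]
    [StarOrderedRing M] {a : M} (ha : 0 ≤ a) : ∃ b, a = star b * b :=
  CStarAlgebra.nonneg_iff_eq_star_mul_self.1 ha

/-- Conjugation by the negative part gives a⁻aa⁻ = -(a⁻)³, and (a⁻)³ is a positive element c⋆c that
vanishes only if a⁻ does. This exhibits a failure of positivity in a form that a quadratic form can
detect. -/
theorem exists_star_conjugate_eq_neg {M : Type*} [CStarAlgebra M] [PartialOrder M]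
    [StarOrderedRing M] {a : M} (ha : IsSelfAdjoint a) :
    ∃ b c : M, star b * a * b = -(star c * c) ∧ (c = 0 → 0 ≤ a) := by
  have hs : IsSelfAdjoint a⁻ := (CFC.negPart_nonneg a).isSelfAdjoint
  have h1 : star a⁻ * a * a⁻ = -(star a⁻ * a⁻ * a⁻) := by
    nth_rw 2 [← CFC.posPart_sub_negPart a ha]
    rw [hs.star_eq, mul_sub, CFC.negPart_mul_posPart, zero_sub, neg_mul]
  obtain ⟨c, hc⟩ := CStarAlgebra.nonneg_iff_eq_star_mul_self.1
    (star_left_conjugate_nonneg (CFC.negPart_nonneg a) a⁻)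
  refine ⟨a⁻, c, by rw [h1, hc], fun h0 => ?_⟩
  rw [h0, mul_zero, hs.star_eq] at hc
  have h4 : (a⁻ * a⁻) * (a⁻ * a⁻) = 0 := by rw [← mul_assoc, hc, zero_mul]
  have h5 : a⁻ * a⁻ = 0 := by
    rw [← CStarRing.star_mul_self_eq_zero_iff]
    simpa [hs.star_eq] using h4
  have h6 : a⁻ = 0 := by
    rw [← CStarRing.star_mul_self_eq_zero_iff]
    simpa [hs.star_eq] using h5
  exact (CFC.negPart_eq_zero_iff a).1 h6

variable {H : Type u} [NormedAddCommGroup H] [InnerProductSpace ℂ H] [CompleteSpace H]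
  {A : VonNeumannAlgebra H} {n : Type*} [Fintype n]

/-- The action of a matrix over a von Neumann algebra on families of vectors. -/
def matrixApply (M : CStarMatrix n n A) (f : n → H) (i : n) : H :=
  ∑ j, (M i j : H →L[ℂ] H) (f j)

/-- The sesquilinear form of a matrix over a von Neumann algebra. -/
def matrixForm (M : CStarMatrix n n A) (f g : n → H) : ℂ :=
  ∑ i, ⟪f i, matrixApply M g i⟫_ℂ

theorem coe_matrix_mul (M N : CStarMatrix n n A) (i j : n) :
    ((M * N) i j : H →L[ℂ] H) = ∑ k, (M i k : H →L[ℂ] H) * (N k j : H →L[ℂ] H) := by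
  rw [CStarMatrix.mul_apply]
  exact map_sum (SubringClass.subtype A) (fun k => M i k * N k j) Finset.univ

theorem matrixApply_mul (M N : CStarMatrix n n A) (f : n → H) :
    matrixApply (M * N) f = matrixApply M (matrixApply N f) := by
  funext i
  simp only [matrixApply, coe_matrix_mul, map_sum, _root_.sum_apply]
  exact Finset.sum_comm

theorem matrixForm_star_left (M : CStarMatrix n n A) (f g : n → H) :
    matrixForm (star M) f g = ∑ i, ⟪matrixApply M f i, g i⟫_ℂ := by
  simp only [matrixForm, matrixApply, inner_sum, sum_inner]
  rw [Finset.sum_comm]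
  refine Finset.sum_congr rfl fun i _ => Finset.sum_congr rfl fun j _ => ?_
  exact ContinuousLinearMap.adjoint_inner_right _ _ _

theorem matrixForm_mul (M N : CStarMatrix n n A) (f g : n → H) :
    matrixForm (M * N) f g = matrixForm M f (matrixApply N g) := by
  simp only [matrixForm, matrixApply_mul]

theorem matrixForm_star_mul_mul (M N : CStarMatrix n n A) (f : n → H) :
    matrixForm (star N * M * N) f f = matrixForm M (matrixApply N f) (matrixApply N f) := by
  rw [matrixForm_mul, matrixForm_mul, matrixForm_star_left]
  rfl

theorem matrixForm_star_mul_self (N : CStarMatrix n n A) (f : n → H) :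
    (matrixForm (star N * N) f f).re = ∑ i, ‖matrixApply N f i‖ ^ 2 := by
  rw [matrixForm_mul, matrixForm_star_left, Complex.re_sum]
  exact Finset.sum_congr rfl fun i _ => inner_self_eq_norm_sq (𝕜 := ℂ) _

theorem eq_zero_of_matrixApply_eq_zero [DecidableEq n] {N : CStarMatrix n n A}
    (h : ∀ f, matrixApply N f = 0) : N = 0 := by
  ext i j v
  have := congrFun (h (Pi.single j v)) i
  simpa [matrixApply, Pi.single_apply, apply_ite] using this

/-- This links the abstract order of the matrix C⋆-algebra to the form on Hⁿ. For the converse, the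
form of `M` at `b f`, with `b` the negative part of `M`, is -‖N f‖², so a nonnegative form forces N
= 0. -/
theorem cstarMatrix_nonneg_iff [DecidableEq n] (M : CStarMatrix n n A) :
    0 ≤ M ↔ IsSelfAdjoint M ∧ ∀ f : n → H, 0 ≤ (matrixForm M f f).re := by
  constructor
  · intro h
    obtain ⟨N, rfl⟩ := exists_eq_star_mul_self_of_nonneg h
    refine ⟨.star_mul_self N, fun f => ?_⟩
    rw [matrixForm_star_mul_self]
    positivity
  · rintro ⟨hM, h⟩
    obtain ⟨b, N, hN, hN0⟩ := exists_star_conjugate_eq_neg hM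
    refine hN0 (eq_zero_of_matrixApply_eq_zero fun f => ?_)
    have h4 := h (matrixApply b f)
    rw [← matrixForm_star_mul_mul, hN] at h4
    have h5 : matrixForm (-(star N * N)) f f = - matrixForm (star N * N) f f := by
      simp only [matrixForm, matrixApply, CStarMatrix.neg_apply, NegMemClass.coe_neg,
        _root_.neg_apply, Finset.sum_neg_distrib, inner_neg_right]
    rw [h5, Complex.neg_re, matrixForm_star_mul_self, Left.nonneg_neg_iff] at h4
    have h6 := (Finset.sum_eq_zero_iff_of_nonneg (fun i _ => by positivity)).1
      (le_antisymm h4 (by positivity))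
    funext i
    simpa using h6 i (Finset.mem_univ i)

/-- Completely positive maps preserve positive kernels. -/
theorem IsPosKernel.map {X : Type*} {k : X → X → A}
    (hk : IsPosKernel fun x y => (k x y : H →L[ℂ] H)) (τ : A →CP A) :
    IsPosKernel fun x y => (τ (k x y) : H →L[ℂ] H) := by
  classical
  -- A quadratic form on finitely supported families involves only finitely many indices, so finite
  -- submatrices suffice.
  have key : ∀ s : Finset X, 0 ≤ (CStarMatrix.ofMatrix fun x y : s => k x y).map τ := fun s => by
    refine τ.map_cstarMatrix_nonneg _ ((cstarMatrix_nonneg_iff _).2 ⟨?_, fun f => ?_⟩)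
    · ext1 x y
      exact Subtype.ext (hk.star_eq y x)
    · let g : X →₀ H := Finsupp.onFinset s (fun x => if h : x ∈ s then f ⟨x, h⟩ else 0)
        (fun x hx => by by_contra h; simp [h] at hx)
      have := hk.nonneg g
      rw [Finsupp.onFinset_sum _ (by simp)] at this
      convert! this using 2
      rw [← Finset.sum_coe_sort s]
      refine Finset.sum_congr rfl fun x _ => ?_
      rw [Finsupp.onFinset_sum _ (by simp), ← Finset.sum_coe_sort s]
      simp [matrixApply]
      rfl
  constructor
  · intro x y
    have := ((cstarMatrix_nonneg_iff _).1 (key {x, y})).1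
    have h2 := congrArg (fun M => M ⟨y, by simp⟩ ⟨x, by simp⟩) this.star_eq
    exact congrArg Subtype.val h2
  · intro f
    have := ((cstarMatrix_nonneg_iff _).1 (key f.support)).2 fun x => f x
    convert! this using 2
    rw [Finsupp.sum, ← Finset.sum_coe_sort]
    refine Finset.sum_congr rfl fun x _ => ?_
    rw [Finsupp.sum, ← Finset.sum_coe_sort]
    simp [matrixApply]
    rfl

end MatrixForm

/-! ### Least upper bounds as weak limits -/

section Normal

open scoped ComplexOrder
open Filter Topology

variable {H : Type u} [NormedAddCommGroup H] [InnerProductSpace ℂ H] [CompleteSpace H]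

theorem ContinuousLinearMap.nonneg_iff_inner (T : H →L[ℂ] H) : 0 ≤ T ↔ ∀ h, 0 ≤ ⟪h, T h⟫_ℂ := by
  rw [ContinuousLinearMap.nonneg_iff_isPositive]
  refine ⟨fun hT h => hT.inner_nonneg_right h, fun hT => ?_⟩
  rw [ContinuousLinearMap.isPositive_iff_complex]
  intro h
  have h1 := Complex.le_def.1 (hT h)
  have h2 : ⟪T h, h⟫_ℂ = star ⟪h, T h⟫_ℂ := (inner_conj_symm _ _).symm
  rw [h2]
  generalize ⟪h, T h⟫_ℂ = z at h1
  constructor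
  · apply Complex.ext
    · simp
    · simpa using h1.2.symm
  · simpa using h1.1

/-- With T = S⋆S, ‖Th‖² ≤ ‖S⋆‖²‖Sh‖². This turns weak convergence of bounded monotone nets into
strong convergence. -/
theorem ContinuousLinearMap.norm_apply_sq_le {T : H →L[ℂ] H} (hT : 0 ≤ T) (h : H) :
    ‖T h‖ ^ 2 ≤ ‖T‖ * (⟪h, T h⟫_ℂ).re := by
  obtain ⟨S, rfl⟩ := CStarAlgebra.nonneg_iff_eq_star_mul_self.1 hT
  have h1 : (⟪h, (star S * S) h⟫_ℂ).re = ‖S h‖ ^ 2 := by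
    change (⟪h, S.adjoint (S h)⟫_ℂ).re = _
    rw [ContinuousLinearMap.adjoint_inner_right]
    exact inner_self_eq_norm_sq (𝕜 := ℂ) _
  rw [h1, CStarRing.norm_star_mul_self, ← sq, ← mul_pow, ← norm_star S]
  gcongr
  exact (star S).le_opNorm (S h)

theorem ContinuousLinearMap.re_inner_le {S T : H →L[ℂ] H} (hST : S ≤ T) (h : H) :
    (⟪h, S h⟫_ℂ).re ≤ (⟪h, T h⟫_ℂ).re := by
  have := (Complex.le_def.1 ((nonneg_iff_inner _).1 (sub_nonneg.2 hST) h)).1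
  rw [_root_.sub_apply, inner_sub_right, Complex.sub_re, Complex.zero_re] at this
  linarith

theorem ContinuousLinearMap.norm_sub_apply_sq_le {S T : H →L[ℂ] H} (hST : S ≤ T) {C : ℝ}
    (hC : ‖T - S‖ ≤ C) (h : H) :
    ‖T h - S h‖ ^ 2 ≤ C * ((⟪h, T h⟫_ℂ).re - (⟪h, S h⟫_ℂ).re) := by
  have h1 := norm_apply_sq_le (sub_nonneg.2 hST) h
  rw [_root_.sub_apply, inner_sub_right, Complex.sub_re] at h1
  have h2 := re_inner_le hST h
  exact h1.trans (mul_le_mul_of_nonneg_right hC (by linarith))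

/-- A bounded increasing net of operators converges strongly. -/
theorem ContinuousLinearMap.exists_tendsto_of_monotone {ι : Type*} [Preorder ι] [Nonempty ι]
    [IsDirectedOrder ι] {g : ι → H →L[ℂ] H} (hg : Monotone g) {d : H →L[ℂ] H}
    (hd : ∀ b, g b ≤ d) (i₀ : ι) (hi₀ : ∀ b, i₀ ≤ b) :
    ∃ s : H →L[ℂ] H, ∀ h, Tendsto (fun b => g b h) atTop (𝓝 (s h)) := by
  obtain ⟨C, hC0⟩ : ∃ C, C = ‖d - g i₀‖ := ⟨_, rfl⟩
  have hCn : 0 ≤ C := hC0 ▸ norm_nonneg _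
  have hC : ∀ b c : ι, b ≤ c → ‖g c - g b‖ ≤ C := fun b c h => by
    rw [hC0]
    refine CStarAlgebra.norm_le_norm_of_nonneg_of_le (sub_nonneg.2 (hg h)) ?_
    exact sub_le_sub (hd c) (hg (hi₀ b))
  have hbd : Bornology.IsBounded (Set.range g) := by
    rw [isBounded_iff_forall_norm_le]
    refine ⟨C + ‖g i₀‖, ?_⟩
    rintro _ ⟨b, rfl⟩
    have h1 := hC i₀ b (hi₀ b)
    have h2 := norm_sub_norm_le (g b) (g i₀)
    linarith
  have hlim : ∀ h, ∃ k, Tendsto (fun b => g b h) atTop (𝓝 k) := fun h => by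
    have hmono : Monotone fun b => (⟪h, g b h⟫_ℂ).re := fun b c hbc => re_inner_le (hg hbc) h
    have hr : BddAbove (Set.range fun b => (⟪h, g b h⟫_ℂ).re) := by
      refine ⟨(⟪h, d h⟫_ℂ).re, ?_⟩
      rintro _ ⟨b, rfl⟩
      exact re_inner_le (hd b) h
    have hsup := tendsto_order.1 (tendsto_atTop_ciSup hmono hr)
    refine cauchy_map_iff_exists_tendsto.1 (Metric.cauchy_iff.2 ⟨inferInstance, fun ε hε => ?_⟩)
    -- Chosen so that C times the gap is below (ε/2)²; the `+ 1` covers C = 0.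
    have hδ : 0 < (ε / 2) ^ 2 / (C + 1) := by positivity
    obtain ⟨N, hN⟩ := (hsup.1 _ (sub_lt_self _ hδ)).exists
    refine ⟨(fun b => g b h) '' Set.Ici N, image_mem_map (Ici_mem_atTop N), ?_⟩
    have key : ∀ b, N ≤ b → dist (g b h) (g N h) < ε / 2 := fun b hb => by
      have h1 := norm_sub_apply_sq_le (hg hb) (hC N b hb) h
      have h2 : (⟪h, g b h⟫_ℂ).re ≤ ⨆ b, (⟪h, g b h⟫_ℂ).re := le_ciSup hr b
      have h3 := hmono hb
      have h4 : ((⟪h, g b h⟫_ℂ).re - (⟪h, g N h⟫_ℂ).re) * (C + 1) < (ε / 2) ^ 2 := by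
        rw [← lt_div_iff₀ (by positivity)]
        linarith
      rw [dist_eq_norm]
      refine lt_of_pow_lt_pow_left₀ 2 (by positivity) (h1.trans_lt (lt_of_le_of_lt ?_ h4))
      rw [mul_comm]
      exact mul_le_mul_of_nonneg_left (by linarith) (sub_nonneg.2 h3)
    rintro _ ⟨b, hb, rfl⟩ _ ⟨c, hc, rfl⟩
    have h1 := dist_triangle_right (g b h) (g c h) (g N h)
    linarith [key b hb, key c hc]
  choose f hf using hlim
  exact ⟨ofTendstoOfBoundedRange f g (tendsto_pi_nhds.2 hf) hbd, hf⟩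

/-- Commuting with a fixed operator survives strong limits, and the algebra is its own double
commutant. -/
theorem VonNeumannAlgebra.mem_of_tendsto (A : VonNeumannAlgebra H) {ι : Type*} {l : Filter ι}
    [l.NeBot] {g : ι → H →L[ℂ] H} (hg : ∀ i, g i ∈ A) {s : H →L[ℂ] H}
    (hs : ∀ h, Tendsto (fun b => g b h) l (𝓝 (s h))) : s ∈ A := by
  rw [← A.commutant_commutant, VonNeumannAlgebra.mem_commutant_iff]
  intro t ht
  ext h
  have h1 : Tendsto (fun b => t (g b h)) l (𝓝 (t (s h))) := (t.continuous.tendsto _).comp (hs h)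
  refine tendsto_nhds_unique h1 ((hs (t h)).congr fun b => ?_)
  exact congrArg (fun T => T h) (VonNeumannAlgebra.mem_commutant_iff.1 ht _ (hg b))

/-- A bounded directed set in a von Neumann algebra converges weakly to an upper bound that lies in
the algebra. -/
theorem VonNeumannAlgebra.exists_weak_limit (A : VonNeumannAlgebra H) {D : Set A}
    (hne : D.Nonempty) (hD : DirectedOn (· ≤ ·) D) {d : A} (hd : d ∈ upperBounds D) :
    ∃ s ∈ upperBounds D, ∀ h : H, ∀ ε > 0, ∃ b ∈ D,
      (⟪h, ((s - b : A) : H →L[ℂ] H) h⟫_ℂ).re < ε := by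
  obtain ⟨b₀, hb₀⟩ := hne
  -- Passing to the part of `D` above one element bounds the net from below, hence in norm.
  let ι := {b : A // b ∈ D ∧ b₀ ≤ b}
  have : Nonempty ι := ⟨⟨b₀, hb₀, le_rfl⟩⟩
  have : IsDirectedOrder ι := ⟨fun b c => by
    obtain ⟨e, he, hbe, hce⟩ := hD b.1 b.2.1 c.1 c.2.1
    exact ⟨⟨e, he, b.2.2.trans hbe⟩, hbe, hce⟩⟩
  let g : ι → H →L[ℂ] H := fun b => (b.1 : H →L[ℂ] H)
  have hg : Monotone g := fun b c h => h
  obtain ⟨s, hs⟩ := ContinuousLinearMap.exists_tendsto_of_monotone hg (d := d)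
    (fun b => hd b.2.1) ⟨b₀, hb₀, le_rfl⟩ fun b => b.2.2
  have hsA : s ∈ A := A.mem_of_tendsto (fun b => b.1.2) hs
  have hub : ∀ b : ι, 0 ≤ s - g b := fun b => by
    rw [ContinuousLinearMap.nonneg_iff_inner]
    intro h
    have h1 : Tendsto (fun c => ⟪h, (g c - g b) h⟫_ℂ) atTop (𝓝 ⟪h, (s - g b) h⟫_ℂ) :=
      tendsto_const_nhds.inner ((hs h).sub_const _)
    refine ge_of_tendsto h1 ?_
    filter_upwards [eventually_ge_atTop b] with c hc
    exact (ContinuousLinearMap.nonneg_iff_inner _).1 (sub_nonneg.2 (hg hc)) h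
  refine ⟨⟨s, hsA⟩, fun b hb => ?_, fun h ε hε => ?_⟩
  · obtain ⟨e, he, hbe, hce⟩ := hD b hb b₀ hb₀
    exact hbe.trans (sub_nonneg.1 (hub ⟨e, he, hce⟩))
  · have h1 : Tendsto (fun b => (⟪h, (s - g b) h⟫_ℂ).re) atTop (𝓝 (⟪h, s h - s h⟫_ℂ).re) :=
      (Complex.continuous_re.tendsto _).comp
        (tendsto_const_nhds.inner (tendsto_const_nhds.sub (hs h)))
    rw [sub_self, inner_zero_right, Complex.zero_re] at h1
    obtain ⟨b, hb⟩ := (h1.eventually_lt_const hε).exists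
    exact ⟨b.1, b.2.1, hb⟩

/-- In a von Neumann algebra the least upper bound of a directed set is its weak limit. -/
theorem VonNeumannAlgebra.isLUB_iff (A : VonNeumannAlgebra H) {D : Set A}
    (hne : D.Nonempty) (hD : DirectedOn (· ≤ ·) D) {d : A} :
    IsLUB D d ↔ d ∈ upperBounds D ∧ ∀ h : H, ∀ ε > 0, ∃ b ∈ D,
      (⟪h, ((d - b : A) : H →L[ℂ] H) h⟫_ℂ).re < ε := by
  constructor
  · intro hd
    refine ⟨hd.1, fun h ε hε => ?_⟩
    obtain ⟨s, hs, hlim⟩ := A.exists_weak_limit hne hD hd.1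
    obtain ⟨b, hb, hlt⟩ := hlim h ε hε
    refine ⟨b, hb, lt_of_le_of_lt ?_ hlt⟩
    have h0 : (0 : H →L[ℂ] H) ≤ (s : H →L[ℂ] H) - d := sub_nonneg.2 (hd.2 hs)
    have := (Complex.le_def.1 ((ContinuousLinearMap.nonneg_iff_inner _).1 h0 h)).1
    simp at this ⊢
    linarith
  · rintro ⟨hub, hlim⟩
    refine ⟨hub, fun u hu => ?_⟩
    obtain ⟨b₀, hb₀⟩ := hne
    have hpos : ∀ b ∈ D, ∀ h, 0 ≤ ⟪h, ((u - b : A) : H →L[ℂ] H) h⟫_ℂ := fun b hb =>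
      (ContinuousLinearMap.nonneg_iff_inner _).1 (sub_nonneg.2 (hu hb) : (0 : H →L[ℂ] H) ≤ u - b)
    have hpos' : ∀ b ∈ D, ∀ h, 0 ≤ ⟪h, ((d - b : A) : H →L[ℂ] H) h⟫_ℂ := fun b hb =>
      (ContinuousLinearMap.nonneg_iff_inner _).1 (sub_nonneg.2 (hub hb) : (0 : H →L[ℂ] H) ≤ d - b)
    suffices h : (0 : H →L[ℂ] H) ≤ (u : H →L[ℂ] H) - d from sub_nonneg.1 h
    rw [ContinuousLinearMap.nonneg_iff_inner]
    intro h
    rw [Complex.le_def]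
    constructor
    · refine le_of_forall_pos_lt_add fun ε hε => ?_
      obtain ⟨b, hb, hlt⟩ := hlim h ε hε
      have := (Complex.le_def.1 (hpos b hb h)).1
      simp at this hlt ⊢
      linarith
    · have h1 := (Complex.le_def.1 (hpos b₀ hb₀ h)).2
      have h2 := (Complex.le_def.1 (hpos' b₀ hb₀ h)).2
      simp at h1 h2 ⊢
      linarith

end Normal

/-! ### The von Neumann algebra of operators with matrix coefficients in `A` -/

section FamilyAlgebra

variable {X : Type*} {H : Type*} [NormedAddCommGroup H] [InnerProductSpace ℂ H] [CompleteSpace H]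
  {K : Type*} [NormedAddCommGroup K] [InnerProductSpace ℂ K] [CompleteSpace K]
  {A : VonNeumannAlgebra H} {Γ : X → H →L[ℂ] K}

theorem IsTotalFamily.eq_of_adjoint_comp (hΓ : IsTotalFamily Γ) {S T : H →L[ℂ] K}
    (h : ∀ x, (Γ x).adjoint ∘L S = (Γ x).adjoint ∘L T) : S = T := by
  ext v
  refine hΓ.ext_inner fun x w => ?_
  rw [← ContinuousLinearMap.adjoint_inner_right, ← ContinuousLinearMap.adjoint_inner_right]
  exact congrArg (fun T : H →L[ℂ] H => ⟪w, T v⟫_ℂ) (h x)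

theorem IsTotalFamily.comp_ext (hΓ : IsTotalFamily Γ) {S T : K →L[ℂ] K}
    (h : ∀ x, S ∘L Γ x = T ∘L Γ x) : S = T :=
  hΓ.ext fun x v => congrArg (fun T : H →L[ℂ] K => T v) (h x)

theorem IsTotalFamily.eq_of_adjoint_comp_comp (hΓ : IsTotalFamily Γ) {S T : K →L[ℂ] K}
    (h : ∀ x y, (Γ x).adjoint ∘L S ∘L Γ y = (Γ x).adjoint ∘L T ∘L Γ y) : S = T :=
  hΓ.comp_ext fun y => hΓ.eq_of_adjoint_comp fun x => h x y

/-- The operators on `K` that restrict along every member of the family to one and the same element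
of the commutant of `A`. -/
def commutantLift (A : VonNeumannAlgebra H) (Γ : X → H →L[ℂ] K) : Set (K →L[ℂ] K) :=
  {s | ∃ t ∈ A.commutant, ∀ x, s ∘L Γ x = Γ x ∘L t}

theorem comp_comm_of_mem_commutant {a t : H →L[ℂ] H} (ha : a ∈ A) (ht : t ∈ A.commutant) :
    a ∘L t = t ∘L a :=
  VonNeumannAlgebra.mem_commutant_iff.1 ht a ha

/-- Tested against Γ y: (sΓy)⋆Γx = t⋆(Γy)⋆Γx = (Γy)⋆Γx t⋆, because the kernel lies in A and t⋆ in
A'. -/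
theorem adjoint_comp_of_comp (hΓ : IsTotalFamily Γ) (hA : ∀ x y, (Γ x).adjoint ∘L Γ y ∈ A)
    {s : K →L[ℂ] K} {t : H →L[ℂ] H} (ht : t ∈ A.commutant) (h : ∀ x, s ∘L Γ x = Γ x ∘L t) (x : X) :
    s.adjoint ∘L Γ x = Γ x ∘L t.adjoint := by
  refine hΓ.eq_of_adjoint_comp fun y => ?_
  have ht' : t.adjoint ∈ A.commutant := star_mem (S := VonNeumannAlgebra H) ht
  rw [← ContinuousLinearMap.comp_assoc, ← ContinuousLinearMap.adjoint_comp, h,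
    ContinuousLinearMap.adjoint_comp, ContinuousLinearMap.comp_assoc,
    ← comp_comm_of_mem_commutant (hA y x) ht', ContinuousLinearMap.comp_assoc]

theorem star_mem_commutantLift (hΓ : IsTotalFamily Γ) (hA : ∀ x y, (Γ x).adjoint ∘L Γ y ∈ A)
    {s : K →L[ℂ] K} (hs : s ∈ commutantLift A Γ) : star s ∈ commutantLift A Γ := by
  obtain ⟨t, ht, h⟩ := hs
  exact ⟨star t, star_mem ht, adjoint_comp_of_comp hΓ hA ht h⟩

/-- A unitary of A' commutes with the kernel, so composing the family with it leaves the kernel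
unchanged; the unitaries span A'. -/
theorem exists_mem_commutantLift (hΓ : IsTotalFamily Γ) (hA : ∀ x y, (Γ x).adjoint ∘L Γ y ∈ A)
    {t : H →L[ℂ] H} (ht : t ∈ A.commutant) : ∃ s : K →L[ℂ] K, ∀ x, s ∘L Γ x = Γ x ∘L t := by
  let π : A.commutant →ₗ[ℂ] X → H →L[ℂ] K :=
    { toFun := fun t x => Γ x ∘L (t : H →L[ℂ] H)
      map_add' := fun s t => by ext; simp
      map_smul' := fun c t => by ext; simp }
  have hπ : ∀ m ∈ unitary A.commutant, ∀ x y,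
      (π m x).adjoint ∘L π m y = (Γ x).adjoint ∘L Γ y := by
    intro m hm x y
    have h1 : (m : H →L[ℂ] H).adjoint ∘L (m : H →L[ℂ] H) = .id ℂ H :=
      congrArg Subtype.val (Unitary.star_mul_self_of_mem hm)
    change (Γ x ∘L (m : H →L[ℂ] H)).adjoint ∘L (Γ y ∘L (m : H →L[ℂ] H)) = _
    rw [ContinuousLinearMap.adjoint_comp, ContinuousLinearMap.comp_assoc,
      ← ContinuousLinearMap.comp_assoc _ _ (m : H →L[ℂ] H),
      comp_comm_of_mem_commutant (hA x y) m.2, ← ContinuousLinearMap.comp_assoc, h1,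
      ContinuousLinearMap.id_comp]
  obtain ⟨s, hs⟩ := hΓ.exists_operator π hπ ⟨t, ht⟩
  exact ⟨s, fun x => ContinuousLinearMap.ext fun v => hs x v⟩

/-- The commutant of `commutantLift A Γ`. -/
def familyAlgebra (A : VonNeumannAlgebra H) (Γ : X → H →L[ℂ] K) : VonNeumannAlgebra K where
  toStarSubalgebra := StarSubalgebra.centralizer ℂ (commutantLift A Γ)
  centralizer_centralizer' := by simp

theorem mem_familyAlgebra_iff_commute (hΓ : IsTotalFamily Γ)
    (hA : ∀ x y, (Γ x).adjoint ∘L Γ y ∈ A) {b : K →L[ℂ] K} :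
    b ∈ familyAlgebra A Γ ↔ ∀ s ∈ commutantLift A Γ, s ∘L b = b ∘L s := by
  change b ∈ StarSubalgebra.centralizer ℂ (commutantLift A Γ) ↔ _
  rw [StarSubalgebra.mem_centralizer_iff]
  exact ⟨fun h s hs => (h s hs).1,
    fun h s hs => ⟨h s hs, h _ (star_mem_commutantLift hΓ hA hs)⟩⟩

/-- A coefficient lies in A = A'' iff it commutes with each t in A'. Since (Γx)⋆s = t(Γx)⋆ and sΓy =
Γy t for the lift s, this is commutation of b with s, seen through the total family. -/
theorem mem_familyAlgebra_iff (hΓ : IsTotalFamily Γ)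
    (hA : ∀ x y, (Γ x).adjoint ∘L Γ y ∈ A) {b : K →L[ℂ] K} :
    b ∈ familyAlgebra A Γ ↔ ∀ x y, (Γ x).adjoint ∘L b ∘L Γ y ∈ A := by
  rw [mem_familyAlgebra_iff_commute hΓ hA]
  have key : ∀ {s : K →L[ℂ] K} {t : H →L[ℂ] H}, t ∈ A.commutant → (∀ x, s ∘L Γ x = Γ x ∘L t) →
      ∀ x, (Γ x).adjoint ∘L s = t ∘L (Γ x).adjoint := fun {s t} ht h x => by
    have h1 := congrArg ContinuousLinearMap.adjoint (adjoint_comp_of_comp hΓ hA ht h x)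
    simpa only [ContinuousLinearMap.adjoint_comp, ContinuousLinearMap.adjoint_adjoint] using h1
  constructor
  · intro h x y
    rw [← A.commutant_commutant, VonNeumannAlgebra.mem_commutant_iff]
    intro t ht
    obtain ⟨s, hs⟩ := exists_mem_commutantLift hΓ hA ht
    have h1 := h s ⟨t, ht, hs⟩
    change t ∘L _ = _ ∘L t
    rw [← ContinuousLinearMap.comp_assoc, ← key ht hs, ContinuousLinearMap.comp_assoc,
      ← ContinuousLinearMap.comp_assoc s, h1]
    simp only [ContinuousLinearMap.comp_assoc, hs]
  · rintro h s ⟨t, ht, hs⟩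
    refine hΓ.eq_of_adjoint_comp_comp fun x y => ?_
    have h1 := comp_comm_of_mem_commutant (h x y) ht
    rw [ContinuousLinearMap.comp_assoc, ContinuousLinearMap.comp_assoc, hs,
      ← ContinuousLinearMap.comp_assoc, key ht hs, ContinuousLinearMap.comp_assoc, ← h1]
    simp only [ContinuousLinearMap.comp_assoc]

end FamilyAlgebra

/-! ### The Stinespring representation and its normality -/

section Stinespring

variable {M : Type u} [CStarAlgebra M] {H : Type u} [NormedAddCommGroup H] [InnerProductSpace ℂ H]
  [CompleteSpace H]

/-- The Stinespring dilation of a completely positive map into the bounded operators. -/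
theorem exists_stinespring (φ : M →ₗ[ℂ] H →L[ℂ] H) (hφ : IsPosKernel fun a b => φ (star a * b)) :
    ∃ (K : Type u) (_ : NormedAddCommGroup K) (_ : InnerProductSpace ℂ K) (_ : CompleteSpace K)
      (Λ : M →ₗ[ℂ] H →L[ℂ] K) (ρ : M →⋆ₐ[ℂ] K →L[ℂ] K), IsTotalFamily Λ ∧
      (∀ a b, (Λ a).adjoint ∘L Λ b = φ (star a * b)) ∧ ∀ a b, ρ a ∘L Λ b = Λ (a * b) := by
  obtain ⟨K, i₁, i₂, i₃, Γ, hΓ, hk⟩ := hφ.exists_family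
  let Λ : M →ₗ[ℂ] H →L[ℂ] K :=
    { toFun := Γ
      -- The kernel is linear in its second variable and the family is total, so the family is
      -- itself linear.
      map_add' := fun a b => hΓ.eq_of_adjoint_comp fun x => by
        rw [ContinuousLinearMap.comp_add, hk, hk, hk, mul_add, map_add]
      map_smul' := fun c a => hΓ.eq_of_adjoint_comp fun x => by
        rw [RingHom.id_apply, ContinuousLinearMap.comp_smul, hk, hk, mul_smul_comm, map_smul] }
  have hΛ : IsTotalFamily Λ := hΓ
  have hkΛ : ∀ a b, (Λ a).adjoint ∘L Λ b = φ (star a * b) := hk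
  let π : M →ₗ[ℂ] M → H →L[ℂ] K :=
    { toFun := fun a b => Λ (a * b)
      map_add' := fun a b => by ext1 c; simp [add_mul]
      map_smul' := fun c a => by ext1 b; simp }
  have hπ : ∀ m ∈ unitary M, ∀ x y, (π m x).adjoint ∘L π m y = (Λ x).adjoint ∘L Λ y := by
    intro m hm x y
    change (Λ (m * x)).adjoint ∘L Λ (m * y) = _
    rw [hkΛ, hkΛ, star_mul, mul_assoc, ← mul_assoc (star m), Unitary.star_mul_self_of_mem hm,
      one_mul]
  choose ρ hρ using fun m => hΛ.exists_operator π hπ m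
  have hρ' : ∀ a b, ρ a ∘L Λ b = Λ (a * b) := fun a b => ContinuousLinearMap.ext (hρ a b)
  refine ⟨K, i₁, i₂, i₃, Λ,
    { toFun := ρ
      map_one' := hΛ.comp_ext fun x => by rw [hρ', one_mul]; rfl
      map_mul' := fun a b => hΛ.comp_ext fun x => by
        rw [hρ', mul_assoc, ← hρ' a, ← hρ' b]; rfl
      map_zero' := hΛ.comp_ext fun x => by simp [hρ']
      map_add' := fun a b => hΛ.comp_ext fun x => by
        rw [ContinuousLinearMap.add_comp, hρ', hρ', hρ', add_mul, map_add]
      commutes' := fun c => hΛ.comp_ext fun x => by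
        rw [hρ', Algebra.algebraMap_eq_smul_one, smul_mul_assoc, one_mul, map_smul,
          Algebra.algebraMap_eq_smul_one, ContinuousLinearMap.smul_comp]
        rfl
      map_star' := fun a => hΛ.eq_of_adjoint_comp_comp fun x y => by
        rw [hρ', ContinuousLinearMap.star_eq_adjoint, ← ContinuousLinearMap.comp_assoc,
          ← ContinuousLinearMap.adjoint_comp, hρ', hkΛ, hkΛ, star_mul, mul_assoc] },
    hΛ, hkΛ, hρ'⟩

end Stinespring

section Normality

open Filter Topology

variable {H : Type u} [NormedAddCommGroup H] [InnerProductSpace ℂ H] [CompleteSpace H]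
  {K : Type v} [NormedAddCommGroup K] [InnerProductSpace ℂ K] [CompleteSpace K]
  {A : VonNeumannAlgebra H} {B : VonNeumannAlgebra K}

/-- Weak convergence of a directed set to an upper bound. -/
def IsWeakLimit (D : Set B) (d : B) : Prop :=
  ∀ ξ : K, ∀ ε > 0, ∃ b ∈ D, (⟪ξ, ((d - b : B) : K →L[ℂ] K) ξ⟫_ℂ).re < ε

/-- The compression as a linear map between von Neumann algebras. -/
def compressₗ (V : H →ₗᵢ[ℂ] K) (h : ∀ b : B, compress V b ∈ A) : B →ₗ[ℂ] A where
  toFun b := ⟨compress V b, h b⟩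
  map_add' a b := Subtype.ext (by ext; simp [compress])
  map_smul' c b := Subtype.ext (by ext; simp [compress])

theorem inner_compress (V : H →ₗᵢ[ℂ] K) (z : K →L[ℂ] K) (h k : H) :
    ⟪h, compress V z k⟫_ℂ = ⟪V h, z (V k)⟫_ℂ := by
  simp only [compress, ContinuousLinearMap.comp_apply, ContinuousLinearMap.adjoint_inner_right]
  rfl

open scoped ComplexOrder in
theorem compress_nonneg (V : H →ₗᵢ[ℂ] K) {z : K →L[ℂ] K} (hz : 0 ≤ z) : 0 ≤ compress V z := by
  rw [ContinuousLinearMap.nonneg_iff_inner] at hz ⊢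
  intro h
  rw [inner_compress]
  exact hz _

theorem compressₗ_mono (V : H →ₗᵢ[ℂ] K) (h : ∀ b : B, compress V b ∈ A) :
    Monotone (compressₗ V h) := fun b c hbc => by
  rw [← sub_nonneg, ← map_sub]
  exact compress_nonneg V (sub_nonneg.2 hbc : (0 : K →L[ℂ] K) ≤ (c : K →L[ℂ] K) - b)

theorem isPosKernel_compress (τ : A →CP A) (V : H →ₗᵢ[ℂ] K) (h : ∀ b : B, compress V b ∈ A) :
    IsPosKernel fun a b : B => (τ (compressₗ V h (star a * b)) : H →L[ℂ] H) := by
  refine IsPosKernel.map (k := fun a b : B => compressₗ V h (star a * b)) ?_ τ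
  convert! isPosKernel_adjoint_comp
    (fun b : B => (b : K →L[ℂ] K) ∘L V.toContinuousLinearMap) using 3 with a b
  rw [ContinuousLinearMap.adjoint_comp]
  rfl

/-- The functionals of the Stinespring dilation are normal on the vectors of the family. -/
theorem IsWeakLimit.exists_lt {τ : A →CP A} (hτ : IsNormalUCP τ) (V : H →ₗᵢ[ℂ] K)
    (h : ∀ b : B, compress V b ∈ A) {D : Set B} (hne : D.Nonempty) (hD : DirectedOn (· ≤ ·) D)
    {d : B} (hub : d ∈ upperBounds D) (hd : IsWeakLimit D d) (c : B) (v : H) {ε : ℝ} (hε : 0 < ε) :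
    ∃ b ∈ D, (⟪v, (τ (compressₗ V h (star c * (d - b) * c)) : H →L[ℂ] H) v⟫_ℂ).re < ε := by
  -- Compressing c⋆bc keeps weak limits, so it maps `D` to a directed set in A with least upper
  -- bound f(d), where normality of τ applies.
  let f : B → A := fun b => compressₗ V h (star c * b * c)
  have hf : Monotone f := fun a b hab =>
    compressₗ_mono V h (star_left_conjugate_le_conjugate hab c)
  have hfD : DirectedOn (· ≤ ·) (f '' D) := by
    rintro _ ⟨a, ha, rfl⟩ _ ⟨b, hb, rfl⟩
    obtain ⟨e, he, hae, hbe⟩ := hD a ha b hb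
    exact ⟨f e, ⟨e, he, rfl⟩, hf hae, hf hbe⟩
  have hsub : ∀ b, f d - f b = compressₗ V h (star c * (d - b) * c) := fun b => by
    rw [← map_sub, mul_sub, sub_mul]
  have hlub : IsLUB (f '' D) (f d) := by
    rw [A.isLUB_iff (hne.image f) hfD]
    refine ⟨?_, fun w δ hδ => ?_⟩
    · rintro _ ⟨b, hb, rfl⟩
      exact hf (hub hb)
    · obtain ⟨b, hb, hlt⟩ := hd ((c : K →L[ℂ] K) (V w)) δ hδ
      refine ⟨f b, ⟨b, hb, rfl⟩, lt_of_eq_of_lt ?_ hlt⟩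
      rw [hsub]
      change (⟪w, compress V _ w⟫_ℂ).re = _
      rw [inner_compress]
      change (⟪V w, (c : K →L[ℂ] K).adjoint (((d - b : B) : K →L[ℂ] K) ((c : K →L[ℂ] K) (V w)))⟫_ℂ).re = _
      rw [ContinuousLinearMap.adjoint_inner_right]
  have hlub2 := hτ.normal (hne.image f) hfD hlub
  have hdir : DirectedOn (· ≤ ·) (τ '' (f '' D)) := by
    rintro _ ⟨a, ha, rfl⟩ _ ⟨b, hb, rfl⟩
    obtain ⟨e, he, hae, hbe⟩ := hfD a ha b hb
    exact ⟨τ e, ⟨e, he, rfl⟩, hτ.normal.monotone hae, hτ.normal.monotone hbe⟩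
  rw [A.isLUB_iff ((hne.image f).image τ) hdir] at hlub2
  obtain ⟨_, ⟨_, ⟨b, hb, rfl⟩, rfl⟩, hlt⟩ := hlub2.2 v ε hε
  refine ⟨b, hb, ?_⟩
  rwa [← map_sub, hsub] at hlt

/-- A representation that is normal on a total family of vectors is normal. -/
theorem IsTotalFamily.exists_inner_lt {L : Type*} [NormedAddCommGroup L] [InnerProductSpace ℂ L]
    [CompleteSpace L] {X : Type*} {Λ : X → H →L[ℂ] L} (hΛ : IsTotalFamily Λ)
    (ρ : B →⋆ₐ[ℂ] L →L[ℂ] L) {D : Set B} (hne : D.Nonempty) (hD : DirectedOn (· ≤ ·) D)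
    {d : B} (hub : d ∈ upperBounds D)
    (h : ∀ x v, ∀ ε > 0, ∃ b ∈ D, (⟪Λ x v, ρ (d - b) (Λ x v)⟫_ℂ).re < ε)
    (ξ : L) {ε : ℝ} (hε : 0 < ε) : ∃ b ∈ D, (⟪ξ, ρ (d - b) ξ⟫_ℂ).re < ε := by
  obtain ⟨b₀, hb₀⟩ := hne
  let ι := {b : B // b ∈ D ∧ b₀ ≤ b}
  have : Nonempty ι := ⟨⟨b₀, hb₀, le_rfl⟩⟩
  have : IsDirectedOrder ι := ⟨fun b c => by
    obtain ⟨e, he, hbe, hce⟩ := hD b.1 b.2.1 c.1 c.2.1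
    exact ⟨⟨e, he, b.2.2.trans hbe⟩, hbe, hce⟩⟩
  have hpos : ∀ a b : B, a ≤ b → 0 ≤ ρ (b - a) := fun a b hab => map_nonneg ρ (sub_nonneg.2 hab)
  obtain ⟨C, hC0⟩ : ∃ C, C = ‖d - b₀‖ := ⟨_, rfl⟩
  have hCn : 0 ≤ C := hC0 ▸ norm_nonneg _
  have hC : ∀ b : ι, ‖ρ (d - b.1)‖ ≤ C := fun b => by
    refine (NonUnitalStarAlgHom.norm_apply_le ρ _).trans ?_
    rw [hC0]
    exact CStarAlgebra.norm_le_norm_of_nonneg_of_le (sub_nonneg.2 (hub b.2.1))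
      (sub_le_sub_left b.2.2 d)
  -- The vectors on which ρ(d - b) tends to 0 form a subspace, closed because ‖ρ(d - b)‖ ≤ C; it
  -- contains the total family.
  let W : Submodule ℂ L :=
    { carrier := {ξ | Tendsto (fun b : ι => ρ (d - b.1) ξ) atTop (𝓝 0)}
      zero_mem' := by simp
      add_mem' := fun {ξ η} hξ hη => by
        have := Tendsto.add (Set.mem_ofPred.1 hξ) (Set.mem_ofPred.1 hη)
        rw [add_zero] at this
        exact this.congr fun b => (map_add _ _ _).symm
      smul_mem' := fun c ξ hξ => by
        have := Tendsto.const_smul (Set.mem_ofPred.1 hξ) c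
        rw [smul_zero] at this
        exact this.congr fun b => (map_smul _ _ _).symm }
  have hWclosed : W.topologicalClosure ≤ W := by
    intro ξ hξ
    refine Metric.tendsto_nhds.2 fun δ hδ => ?_
    obtain ⟨η, hη, hd⟩ := Metric.mem_closure_iff.1 hξ (δ / 2 / (C + 1)) (by positivity)
    filter_upwards [Metric.tendsto_nhds.1 (Set.mem_ofPred.1 hη) (δ / 2) (by positivity)] with b hb
    rw [dist_zero_right] at hb ⊢
    have h1 : ρ (d - b.1) ξ = ρ (d - b.1) (ξ - η) + ρ (d - b.1) η := by
      rw [← map_add, sub_add_cancel]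
    have h2 : ‖ρ (d - b.1) (ξ - η)‖ ≤ C * ‖ξ - η‖ := (ρ (d - b.1)).le_of_opNorm_le (hC b) _
    have h3 : C * ‖ξ - η‖ ≤ δ / 2 := by
      rw [dist_eq_norm, lt_div_iff₀ (by positivity)] at hd
      nlinarith [norm_nonneg (ξ - η)]
    rw [h1]
    exact (norm_add_le _ _).trans_lt (by linarith)
  have hWtop : ξ ∈ W := by
    refine hWclosed (Submodule.topologicalClosure_mono (Submodule.span_le.2 ?_)
      ((hΛ ▸ Submodule.mem_top : ξ ∈ (Submodule.span ℂ {k : L | ∃ x h, Λ x h = k}).topologicalClosure)))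
    rintro _ ⟨x, v, rfl⟩
    refine Metric.tendsto_nhds.2 fun δ hδ => ?_
    obtain ⟨b, hb, hlt⟩ := h x v (δ ^ 2 / (C + 1)) (by positivity)
    obtain ⟨e, he, hbe, hce⟩ := hD b hb b₀ hb₀
    filter_upwards [eventually_ge_atTop (⟨e, he, hce⟩ : ι)] with i hi
    rw [dist_zero_right]
    have h1 := ContinuousLinearMap.norm_apply_sq_le (hpos _ _ (hub i.2.1)) (Λ x v)
    have h2 : (⟪Λ x v, ρ (d - i.1) (Λ x v)⟫_ℂ).re ≤ (⟪Λ x v, ρ (d - b) (Λ x v)⟫_ℂ).re := by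
      refine ContinuousLinearMap.re_inner_le ?_ _
      rw [← sub_nonneg, ← map_sub, sub_sub_sub_cancel_left]
      exact hpos _ _ (hbe.trans hi)
    rw [lt_div_iff₀ (by positivity)] at hlt
    refine lt_of_pow_lt_pow_left₀ 2 hδ.le (h1.trans_lt (lt_of_le_of_lt ?_ hlt))
    have h3 : 0 ≤ (⟪Λ x v, ρ (d - i.1) (Λ x v)⟫_ℂ).re := by
      simpa using ContinuousLinearMap.re_inner_le (hpos _ _ (hub i.2.1)) (Λ x v)
    nlinarith [hC i]
  have h1 : Tendsto (fun b : ι => (⟪ξ, ρ (d - b.1) ξ⟫_ℂ).re) atTop (𝓝 (⟪ξ, (0 : L)⟫_ℂ).re) :=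
    (Complex.continuous_re.tendsto _).comp (tendsto_const_nhds.inner (Set.mem_ofPred.1 hWtop))
  rw [inner_zero_right, Complex.zero_re] at h1
  obtain ⟨b, hb⟩ := (h1.eventually_lt_const hε).exists
  exact ⟨b.1, b.2.1, hb⟩

end Normality

section ApproximateUnit

/-- `D` is the set of positive elements of the open unit ball. Order is asserted only for the images
in `M`, since `N` receives its order inside the proof. -/
theorem NonUnitalStarAlgHom.exists_directed_approximateUnit {N M : Type*} [NonUnitalCStarAlgebra N]
    [CStarAlgebra M] [PartialOrder M] [StarOrderedRing M] (f : N →⋆ₙₐ[ℂ] M) :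
    ∃ D : Set N, D.Nonempty ∧ DirectedOn (· ≤ ·) (f '' D) ∧ (∀ u ∈ D, 0 ≤ f u ∧ f u ≤ 1) ∧
      ∀ m, ∀ ε > 0, ∃ u ∈ D, ‖m - u * m‖ < ε := by
  let _ : PartialOrder N := CStarAlgebra.spectralOrder N
  have : StarOrderedRing N := CStarAlgebra.spectralOrderedRing N
  have hf : Monotone f := OrderHomClass.mono f
  refine ⟨{x | 0 ≤ x} ∩ Metric.ball 0 1, ⟨0, by simp⟩, ?_, fun u hu => ?_, fun m ε hε => ?_⟩
  · rintro _ ⟨a, ha, rfl⟩ _ ⟨b, hb, rfl⟩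
    obtain ⟨e, he, hae, hbe⟩ := CStarAlgebra.directedOn_nonneg_ball a ha b hb
    exact ⟨f e, ⟨e, he, rfl⟩, hf hae, hf hbe⟩
  · have h0 : 0 ≤ f u := map_nonneg f hu.1
    have h1 : ‖u‖ < 1 := by simpa using hu.2
    exact ⟨h0, (CStarAlgebra.norm_le_one_iff_of_nonneg _ h0).1
      ((NonUnitalStarAlgHom.norm_apply_le f u).trans h1.le)⟩
  · have h1 := (CStarAlgebra.increasingApproximateUnit N).tendsto_mul_right m
    have h2 := h1.eventually (Metric.ball_mem_nhds m hε)
    rw [(CStarAlgebra.hasBasis_approximateUnit N).eventually_iff] at h2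
    obtain ⟨a, ha, h3⟩ := h2
    have h4 := h3 (x := a) ⟨by simp, by simpa using ha.2.le⟩
    refine ⟨a, ⟨ha.1, by simpa using ha.2⟩, ?_⟩
    rw [← dist_eq_norm, dist_comm]
    exact h4

end ApproximateUnit

/-! ### The positive kernel on words -/

section WordKernel

variable {H : Type u} [NormedAddCommGroup H] [InnerProductSpace ℂ H] [CompleteSpace H]
  {A : VonNeumannAlgebra H}

/-- The kernel `x₀⋆ τ(x₁⋆ τ(⋯) y₁) y₀` on words, cut off at depth `n`. -/
def truncatedWordKernel (τ : A →CP A) : ℕ → List A → List A → A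
  | 0, _, _ => 1
  | n + 1, x, y => star (x.headD 1) * τ (truncatedWordKernel τ n x.tail y.tail) * y.headD 1

/-- The kernel `x₀⋆ τ(x₁⋆ τ(⋯) y₁) y₀` on words, the shorter of which is padded by `1`. -/
def wordKernel (τ : A →CP A) (x y : List A) : A :=
  truncatedWordKernel τ (max x.length y.length) x y

variable {τ : A →CP A}

/-- Beyond the ends of both words the additional layer is 1⋆τ(1)1 = 1. -/
theorem truncatedWordKernel_succ (hτ : τ 1 = 1) :
    ∀ (n : ℕ) (x y : List A), x.length ≤ n → y.length ≤ n →
      truncatedWordKernel τ (n + 1) x y = truncatedWordKernel τ n x y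
  | 0, x, y, hx, hy => by
    rw [List.length_eq_zero_iff.1 (Nat.le_zero.1 hx), List.length_eq_zero_iff.1 (Nat.le_zero.1 hy)]
    simp [truncatedWordKernel, hτ]
  | n + 1, x, y, hx, hy => by
    rw [truncatedWordKernel, truncatedWordKernel_succ hτ n x.tail y.tail
      (by rw [List.length_tail]; omega) (by rw [List.length_tail]; omega), truncatedWordKernel]

theorem truncatedWordKernel_eq (hτ : τ 1 = 1) {n : ℕ} {x y : List A} (hx : x.length ≤ n)
    (hy : y.length ≤ n) : truncatedWordKernel τ n x y = wordKernel τ x y := by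
  induction n, (max_le hx hy : max x.length y.length ≤ n) using Nat.le_induction with
  | base => rfl
  | succ n h ih =>
    have hx' := (le_max_left _ _).trans h
    have hy' := (le_max_right _ _).trans h
    rw [truncatedWordKernel_succ hτ n x y hx' hy', ih hx' hy']

theorem wordKernel_eq (hτ : τ 1 = 1) (x y : List A) :
    wordKernel τ x y = star (x.headD 1) * τ (wordKernel τ x.tail y.tail) * y.headD 1 := by
  rw [← truncatedWordKernel_eq hτ (n := max x.length y.length + 1) (by omega) (by omega),
    truncatedWordKernel, truncatedWordKernel_eq hτ]
  · rw [List.length_tail]; omega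
  · rw [List.length_tail]; omega

theorem IsPosKernel.conj {X Y : Type u} {k : Y → Y → H →L[ℂ] H} (hk : IsPosKernel k) (g : X → Y)
    (a : X → H →L[ℂ] H) : IsPosKernel fun x y => star (a x) * k (g x) (g y) * a y := by
  obtain ⟨K, _, _, _, Γ, -, h⟩ := hk.exists_family
  convert! isPosKernel_adjoint_comp fun x => Γ (g x) ∘L a x using 3 with x y
  rw [ContinuousLinearMap.adjoint_comp, ContinuousLinearMap.comp_assoc,
    ← ContinuousLinearMap.comp_assoc (Γ (g x)).adjoint, h]
  rfl

theorem isPosKernel_truncatedWordKernel (τ : A →CP A) :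
    ∀ n, IsPosKernel fun x y => (truncatedWordKernel τ n x y : H →L[ℂ] H)
  | 0 => by
    convert! isPosKernel_adjoint_comp fun _ : List A => ContinuousLinearMap.id ℂ H using 3
    ext1 v
    simp [truncatedWordKernel, ContinuousLinearMap.adjoint_id]
  | n + 1 => (IsPosKernel.map (isPosKernel_truncatedWordKernel τ n) τ).conj List.tail
      fun x => ((x.headD 1 : A) : H →L[ℂ] H)

/-- A finitely supported family meets finitely many words, and one depth serves them all. -/
theorem isPosKernel_wordKernel (hτ : τ 1 = 1) :
    IsPosKernel fun x y => (wordKernel τ x y : H →L[ℂ] H) where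
  star_eq x y := by
    rw [← truncatedWordKernel_eq hτ (le_max_left x.length y.length) (le_max_right _ _),
      ← truncatedWordKernel_eq hτ (le_max_right x.length y.length) (le_max_left _ _)]
    exact (isPosKernel_truncatedWordKernel τ _).star_eq x y
  nonneg f := by
    have h := (isPosKernel_truncatedWordKernel τ (f.support.sup List.length)).nonneg f
    have e : (f.sum fun x v => f.sum fun y w => ⟪v, (wordKernel τ x y : H →L[ℂ] H) w⟫_ℂ) =
        f.sum fun x v => f.sum fun y w => ⟪v,
          (truncatedWordKernel τ (f.support.sup List.length) x y : H →L[ℂ] H) w⟫_ℂ :=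
      Finset.sum_congr rfl fun x hx => Finset.sum_congr rfl fun y hy => by
        beta_reduce
        rw [truncatedWordKernel_eq hτ (Finset.le_sup (f := List.length) hx)
          (Finset.le_sup (f := List.length) hy)]
    rwa [e]

end WordKernel

/-! ### The dilation space, its algebra and its endomorphism -/

section WordSpace

variable {H : Type u} [NormedAddCommGroup H] [InnerProductSpace ℂ H] [CompleteSpace H]
  {A : VonNeumannAlgebra H} {τ : A →CP A}
  {K : Type u} [NormedAddCommGroup K] [InnerProductSpace ℂ K] [CompleteSpace K]
  {Γ : List A → H →L[ℂ] K}

/-- A decomposition of the word kernel: `Γ [x₀, …, xₙ] h` is the vector `θⁿ(xₙ) ⋯ θ(x₁) x₀ h` of the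
dilation space. -/
structure IsWordFamily (τ : A →CP A) (Γ : List A → H →L[ℂ] K) : Prop where
  map_one : τ 1 = 1
  total : IsTotalFamily Γ
  kernel (x y : List A) : (Γ x).adjoint ∘L Γ y = (wordKernel τ x y : H →L[ℂ] H)

namespace IsWordFamily

theorem kernel_mem (hΓ : IsWordFamily τ Γ) (x y : List A) : (Γ x).adjoint ∘L Γ y ∈ A := by
  rw [hΓ.kernel]; exact (wordKernel τ x y).2

theorem kernel_nil (_ : IsWordFamily τ Γ) : wordKernel τ [] [] = 1 := by
  simp [wordKernel, truncatedWordKernel]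

/-- The inclusion of `H` as the space of empty words. -/
def incl (hΓ : IsWordFamily τ Γ) : H →ₗᵢ[ℂ] K where
  toLinearMap := Γ []
  norm_map' h := by
    have h1 : (Γ []).adjoint (Γ [] h) = h := by
      have := congrArg (fun T : H →L[ℂ] H => T h) (hΓ.kernel [] [])
      rw [hΓ.kernel_nil] at this
      exact this
    have h2 : ‖Γ [] h‖ ^ 2 = ‖h‖ ^ 2 := by
      rw [← inner_self_eq_norm_sq (𝕜 := ℂ), ← inner_self_eq_norm_sq (𝕜 := ℂ),
        ← ContinuousLinearMap.adjoint_inner_right, h1]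
    exact (pow_left_inj₀ (norm_nonneg _) (norm_nonneg _) two_ne_zero).1 h2

theorem adjoint_comp_nil (hΓ : IsWordFamily τ Γ) : (Γ []).adjoint ∘L Γ [] = .id ℂ H := by
  rw [hΓ.kernel, hΓ.kernel_nil]; rfl

/-- A letter can be absorbed into a word. -/
theorem comp_eq (hΓ : IsWordFamily τ Γ) (x : List A) (a : A) :
    Γ x ∘L (a : H →L[ℂ] H) = Γ ((x.headD 1 * a) :: x.tail) := by
  refine hΓ.total.eq_of_adjoint_comp fun y => ?_
  rw [← ContinuousLinearMap.comp_assoc, hΓ.kernel, hΓ.kernel, wordKernel_eq hΓ.map_one y x,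
    wordKernel_eq hΓ.map_one y (_ :: _)]
  change ((_ * a : A) : H →L[ℂ] H) = _
  rw [List.headD_cons, List.tail_cons, mul_assoc]

/-- The algebra of the dilation. -/
abbrev algebra (_ : IsWordFamily τ Γ) : VonNeumannAlgebra K := familyAlgebra A Γ

theorem mem_algebra_iff (hΓ : IsWordFamily τ Γ) {b : K →L[ℂ] K} :
    b ∈ hΓ.algebra ↔ ∀ x y, (Γ x).adjoint ∘L b ∘L Γ y ∈ A :=
  mem_familyAlgebra_iff hΓ.total hΓ.kernel_mem

theorem compress_mem (hΓ : IsWordFamily τ Γ) (b : hΓ.algebra) : compress hΓ.incl b ∈ A :=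
  hΓ.mem_algebra_iff.1 b.2 [] []

/-- The operator of the dilation algebra that maps `h` to `Γ x h` and vanishes on the orthogonal
complement of `H`. -/
def word (hΓ : IsWordFamily τ Γ) (x : List A) : hΓ.algebra :=
  ⟨Γ x ∘L (Γ []).adjoint, hΓ.mem_algebra_iff.2 fun y z => by
    rw [ContinuousLinearMap.comp_assoc, hΓ.kernel, ← ContinuousLinearMap.comp_assoc, hΓ.kernel]
    exact (wordKernel τ y x * wordKernel τ [] z).2⟩

theorem word_comp (hΓ : IsWordFamily τ Γ) (x : List A) :
    (hΓ.word x : K →L[ℂ] K) ∘L Γ [] = Γ x := by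
  change (Γ x ∘L (Γ []).adjoint) ∘L Γ [] = _
  rw [ContinuousLinearMap.comp_assoc, hΓ.adjoint_comp_nil, ContinuousLinearMap.comp_id]

theorem compress_star_mul_mul (hΓ : IsWordFamily τ Γ) (x y : List A) (b : hΓ.algebra) :
    ((compressₗ hΓ.incl hΓ.compress_mem (star (hΓ.word x) * b * hΓ.word y) : A) : H →L[ℂ] H) =
      (Γ x).adjoint ∘L (b : K →L[ℂ] K) ∘L Γ y := by
  change (Γ []).adjoint ∘L (((hΓ.word x : K →L[ℂ] K).adjoint ∘L (b : K →L[ℂ] K)) ∘L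
    (hΓ.word y : K →L[ℂ] K)) ∘L Γ [] = _
  rw [ContinuousLinearMap.comp_assoc, hΓ.word_comp]
  simp only [← ContinuousLinearMap.comp_assoc]
  rw [← ContinuousLinearMap.adjoint_comp, hΓ.word_comp]

theorem compress_star_mul (hΓ : IsWordFamily τ Γ) (x y : List A) :
    compressₗ hΓ.incl hΓ.compress_mem (star (hΓ.word x) * hΓ.word y) = wordKernel τ x y := by
  have h := hΓ.compress_star_mul_mul x y 1
  rw [mul_one] at h
  refine Subtype.ext (h.trans ?_)
  rw [← hΓ.kernel]
  rfl

section Representation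

variable {L : Type u} [NormedAddCommGroup L] [InnerProductSpace ℂ L] [CompleteSpace L]
  (hΓ : IsWordFamily τ Γ) {Λ : hΓ.algebra →ₗ[ℂ] H →L[ℂ] L} {ρ : hΓ.algebra →⋆ₐ[ℂ] L →L[ℂ] L}
  {U : K →ₗᵢ[ℂ] L}

/-- The kernel τ(pa⋆bp) sees b only through bp. -/
theorem map_eq_of_comp_eq (hΛ : IsTotalFamily Λ)
    (hk : ∀ a b, (Λ a).adjoint ∘L Λ b =
      (τ (compressₗ hΓ.incl hΓ.compress_mem (star a * b)) : H →L[ℂ] H))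
    {b c : hΓ.algebra} (h : (b : K →L[ℂ] K) ∘L Γ [] = (c : K →L[ℂ] K) ∘L Γ []) : Λ b = Λ c := by
  refine hΛ.eq_of_adjoint_comp fun a => ?_
  rw [hk, hk]
  congr 2
  refine Subtype.ext ?_
  change (Γ []).adjoint ∘L ((a : K →L[ℂ] K).adjoint ∘L (b : K →L[ℂ] K)) ∘L Γ [] =
    (Γ []).adjoint ∘L ((a : K →L[ℂ] K).adjoint ∘L (c : K →L[ℂ] K)) ∘L Γ []
  rw [ContinuousLinearMap.comp_assoc, ContinuousLinearMap.comp_assoc, h]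

/-- The isometry that identifies the vector `θⁿ(xₙ) ⋯ θ(x₁) x₀ h` with `θ(θⁿ⁻¹(xₙ) ⋯ x₁) x₀ h`. -/
theorem exists_wordIsometry
    (hk : ∀ a b, (Λ a).adjoint ∘L Λ b =
      (τ (compressₗ hΓ.incl hΓ.compress_mem (star a * b)) : H →L[ℂ] H)) :
    ∃ U : K →ₗᵢ[ℂ] L, ∀ x, U.toContinuousLinearMap ∘L Γ x =
      Λ (hΓ.word x.tail) ∘L ((x.headD 1 : A) : H →L[ℂ] H) := by
  obtain ⟨U, hU⟩ := hΓ.total.exists_isometry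
    (fun x => Λ (hΓ.word x.tail) ∘L ((x.headD 1 : A) : H →L[ℂ] H)) fun x y => by
      rw [ContinuousLinearMap.adjoint_comp, ContinuousLinearMap.comp_assoc,
        ← ContinuousLinearMap.comp_assoc _ (Λ (hΓ.word y.tail)), hk, hΓ.compress_star_mul,
        hΓ.kernel, wordKernel_eq hΓ.map_one x y, mul_assoc]
      rfl
  exact ⟨U, fun x => ContinuousLinearMap.ext (hU x)⟩

/-- On Λ c the operator gives Λ of (Γx)(Γy)⋆c, whose restriction to H is Γx α with α = (Γy)⋆cΓ[] in
A. The letter α is absorbed into x, which leaves Λ of a word, a value of U. -/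
theorem rep_word_mul_star_word_mem (hΛ : IsTotalFamily Λ)
    (hk : ∀ a b, (Λ a).adjoint ∘L Λ b =
      (τ (compressₗ hΓ.incl hΓ.compress_mem (star a * b)) : H →L[ℂ] H))
    (hρ : ∀ a b, ρ a ∘L Λ b = Λ (a * b))
    (hU : ∀ x, U.toContinuousLinearMap ∘L Γ x =
      Λ (hΓ.word x.tail) ∘L ((x.headD 1 : A) : H →L[ℂ] H))
    (x y : List A) (ξ : L) : ρ (hΓ.word x * star (hΓ.word y)) ξ ∈ Set.range U := by
  have hcl : IsClosed (Set.range U) := U.isometry.isClosedEmbedding.isClosed_range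
  refine hΛ.denseRange.induction_on (p := fun ξ => ρ (hΓ.word x * star (hΓ.word y)) ξ ∈ Set.range U)
    ξ (hcl.preimage (ρ _).continuous) fun f => ?_
  suffices h : synthesis Λ f ∈
      (LinearMap.range U.toLinearMap).comap (ρ (hΓ.word x * star (hΓ.word y))).toLinearMap from h
  rw [synthesis_apply, Finsupp.sum]
  refine Submodule.sum_mem _ fun c _ => ?_
  let α : A := ⟨(Γ y).adjoint ∘L (c : K →L[ℂ] K) ∘L Γ [], hΓ.mem_algebra_iff.1 c.2 y []⟩
  let z : List A := (x.headD 1 * α) :: x.tail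
  have hz : Λ (hΓ.word x * star (hΓ.word y) * c) = Λ (hΓ.word z) := by
    refine hΓ.map_eq_of_comp_eq hΛ hk ?_
    rw [hΓ.word_comp, ← hΓ.comp_eq]
    change (((hΓ.word x : K →L[ℂ] K) ∘L (hΓ.word y : K →L[ℂ] K).adjoint) ∘L (c : K →L[ℂ] K)) ∘L
      Γ [] = Γ x ∘L ((Γ y).adjoint ∘L (c : K →L[ℂ] K) ∘L Γ [])
    have h1 : (hΓ.word x : K →L[ℂ] K) ∘L (hΓ.word y : K →L[ℂ] K).adjoint =
        Γ x ∘L (Γ y).adjoint := by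
      change (hΓ.word x : K →L[ℂ] K) ∘L (Γ y ∘L (Γ []).adjoint).adjoint = _
      rw [ContinuousLinearMap.adjoint_comp, ContinuousLinearMap.adjoint_adjoint,
        ← ContinuousLinearMap.comp_assoc, hΓ.word_comp]
    rw [h1]
    simp only [ContinuousLinearMap.comp_assoc]
  change ρ _ (Λ c (f c)) ∈ LinearMap.range U.toLinearMap
  have h1 : ρ (hΓ.word x * star (hΓ.word y)) (Λ c (f c)) = Λ (hΓ.word z) (f c) := by
    rw [← hz, ← hρ]; rfl
  -- U strips the first letter and applies it to the vector, so a leading 1 yields Λ of the word z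
  -- itself.
  refine ⟨Γ (1 :: z) (f c), ?_⟩
  rw [h1]
  exact congrArg (fun T : H →L[ℂ] L => T (f c)) (hU (1 :: z))

theorem exists_inner_lt (hτ : IsNormalUCP τ) (hΛ : IsTotalFamily Λ)
    (hk : ∀ a b, (Λ a).adjoint ∘L Λ b =
      (τ (compressₗ hΓ.incl hΓ.compress_mem (star a * b)) : H →L[ℂ] H))
    (hρ : ∀ a b, ρ a ∘L Λ b = Λ (a * b)) {D : Set hΓ.algebra} (hne : D.Nonempty)
    (hD : DirectedOn (· ≤ ·) D) {d : hΓ.algebra} (hub : d ∈ upperBounds D) (hd : IsWeakLimit D d)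
    (ξ : L) {ε : ℝ} (hε : 0 < ε) : ∃ b ∈ D, (⟪ξ, ρ (d - b) ξ⟫_ℂ).re < ε := by
  refine hΛ.exists_inner_lt ρ hne hD hub (fun c v δ hδ => ?_) ξ hε
  obtain ⟨b, hb, hlt⟩ := hd.exists_lt hτ hΓ.incl hΓ.compress_mem hne hD hub c v hδ
  refine ⟨b, hb, lt_of_eq_of_lt ?_ hlt⟩
  rw [mul_assoc, ← hk, ← hρ, ContinuousLinearMap.comp_apply,
    ContinuousLinearMap.adjoint_inner_right]
  rfl

/-- The b for which ρ(b) and ρ(b⋆) map L into the range of U form a C⋆-algebra `J` containing all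
(Γx)(Γy)⋆. These make an approximate unit of `J` converge weakly to 1 on K. By normality of ρ the
vectors ρ(u)ξ, which lie in the closed range, come arbitrarily close to ξ. -/
theorem surjective_wordIsometry (hτ : IsNormalUCP τ) (hΛ : IsTotalFamily Λ)
    (hk : ∀ a b, (Λ a).adjoint ∘L Λ b =
      (τ (compressₗ hΓ.incl hΓ.compress_mem (star a * b)) : H →L[ℂ] H))
    (hρ : ∀ a b, ρ a ∘L Λ b = Λ (a * b))
    (hU : ∀ x, U.toContinuousLinearMap ∘L Γ x =
      Λ (hΓ.word x.tail) ∘L ((x.headD 1 : A) : H →L[ℂ] H)) : Function.Surjective U := by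
  have hcl : IsClosed (Set.range U) := U.isometry.isClosedEmbedding.isClosed_range
  let R : Submodule ℂ L := LinearMap.range U.toLinearMap
  have hRcl : IsClosed (R : Set L) := hcl
  let J : NonUnitalStarSubalgebra ℂ hΓ.algebra :=
    { carrier := {b | ∀ ξ, ρ b ξ ∈ R ∧ ρ (star b) ξ ∈ R}
      zero_mem' := fun ξ => by simp
      add_mem' := fun {a b} ha hb ξ => by
        rw [star_add, map_add, map_add]
        exact ⟨R.add_mem (ha ξ).1 (hb ξ).1, R.add_mem (ha ξ).2 (hb ξ).2⟩
      mul_mem' := fun {a b} ha hb ξ => by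
        rw [star_mul, map_mul, map_mul]
        exact ⟨(ha _).1, (hb _).2⟩
      smul_mem' := fun c a ha ξ => by
        rw [star_smul, map_smul, map_smul]
        exact ⟨R.smul_mem _ (ha ξ).1, R.smul_mem _ (ha ξ).2⟩
      star_mem' := fun {a} ha ξ => by
        rw [star_star]
        exact (ha ξ).symm }
  have hρc : Continuous ρ := AddMonoidHomClass.continuous_of_bound ρ 1 fun b => by
    rw [one_mul]; exact NonUnitalStarAlgHom.norm_apply_le ρ b
  have hJ : IsClosed (J : Set hΓ.algebra) := by
    have h1 : (J : Set hΓ.algebra) =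
        ⋂ ξ, ((fun b => ρ b ξ) ⁻¹' R ∩ (fun b => ρ (star b) ξ) ⁻¹' R) := by
      ext b
      simp only [Set.mem_iInter]
      rfl
    rw [h1]
    refine isClosed_iInter fun ξ => (hRcl.preimage ?_).inter (hRcl.preimage ?_)
    · exact (ContinuousLinearMap.apply ℂ L ξ).continuous.comp hρc
    · exact (ContinuousLinearMap.apply ℂ L ξ).continuous.comp (hρc.comp continuous_star)
  obtain ⟨D, hne, hD, hD1, happ⟩ :=
    (NonUnitalStarSubalgebraClass.subtype J).exists_directed_approximateUnit
  let D' : Set hΓ.algebra := (NonUnitalStarSubalgebraClass.subtype J) '' D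
  have hub : (1 : hΓ.algebra) ∈ upperBounds D' := by
    rintro _ ⟨u, hu, rfl⟩
    exact (hD1 u hu).2
  have hlim : IsWeakLimit D' 1 := by
    let i : hΓ.algebra →⋆ₐ[ℂ] K →L[ℂ] K := hΓ.algebra.toStarSubalgebra.subtype
    intro ξ ε hε
    refine hΓ.total.exists_inner_lt i (hne.image _) hD hub (fun x v δ hδ => ?_) ξ hε
    -- This m maps Γ[]v to Γx v, so (1 - u)Γx v = (m - um)Γ[]v is small in norm.
    let m : J := ⟨hΓ.word x * star (hΓ.word []), fun ξ =>
      ⟨hΓ.rep_word_mul_star_word_mem hΛ hk hρ hU _ _ ξ, by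
        rw [star_mul, star_star]
        exact hΓ.rep_word_mul_star_word_mem hΛ hk hρ hU _ _ ξ⟩⟩
    have hm : (((m : hΓ.algebra) : K →L[ℂ] K)) (Γ [] v) = Γ x v := by
      have h1 : ((hΓ.word x : K →L[ℂ] K) ∘L (Γ [] ∘L (Γ []).adjoint).adjoint) ∘L Γ [] = Γ x := by
        rw [ContinuousLinearMap.adjoint_comp, ContinuousLinearMap.adjoint_adjoint,
          ContinuousLinearMap.comp_assoc, ContinuousLinearMap.comp_assoc, hΓ.adjoint_comp_nil,
          ContinuousLinearMap.comp_id, hΓ.word_comp]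
      exact congrArg (fun T : H →L[ℂ] K => T v) h1
    obtain ⟨u, hu, hlt⟩ := happ m (δ / (‖Γ x v‖ * ‖Γ [] v‖ + 1)) (by positivity)
    refine ⟨_, ⟨u, hu, rfl⟩, ?_⟩
    have h2 : i (1 - NonUnitalStarSubalgebraClass.subtype J u) (Γ x v) =
        (((m - u * m : J) : hΓ.algebra) : K →L[ℂ] K) (Γ [] v) := by
      rw [← hm]
      change (((1 - (u : hΓ.algebra)) * (m : hΓ.algebra) : hΓ.algebra) : K →L[ℂ] K) (Γ [] v) = _
      rw [sub_mul, one_mul]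
      rfl
    have h3 : ‖(((m - u * m : J) : hΓ.algebra) : K →L[ℂ] K) (Γ [] v)‖ ≤
        ‖m - u * m‖ * ‖Γ [] v‖ := ContinuousLinearMap.le_opNorm _ _
    rw [h2]
    refine (Complex.re_le_norm _).trans_lt ((norm_inner_le_norm _ _).trans_lt ?_)
    rw [lt_div_iff₀ (by positivity)] at hlt
    have h4 : 0 ≤ ‖Γ x v‖ := norm_nonneg _
    have h5 : 0 ≤ ‖Γ [] v‖ := norm_nonneg _
    have h6 : 0 ≤ ‖m - u * m‖ := norm_nonneg _
    have h7 := mul_le_mul_of_nonneg_left h3 h4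
    nlinarith
  intro ξ
  suffices h : ξ ∈ R from h
  rw [← SetLike.mem_coe, ← hRcl.closure_eq, Metric.mem_closure_iff]
  intro ε hε
  obtain ⟨_, ⟨u, hu, rfl⟩, hlt⟩ := hΓ.exists_inner_lt hτ hΛ hk hρ (hne.image _) hD hub hlim ξ
    (sq_pos_of_pos hε)
  refine ⟨ρ (u : hΓ.algebra) ξ, (u.2 ξ).1, ?_⟩
  have h0 : 0 ≤ (1 : hΓ.algebra) - u := sub_nonneg.2 (hD1 u hu).2
  have h1 : (1 : hΓ.algebra) - u ≤ 1 := sub_le_self _ (hD1 u hu).1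
  have h2 : ‖ρ (1 - (u : hΓ.algebra))‖ ≤ 1 := (NonUnitalStarAlgHom.norm_apply_le ρ _).trans
    ((CStarAlgebra.norm_le_one_iff_of_nonneg _ h0).2 h1)
  have h3 : 0 ≤ ρ (1 - (u : hΓ.algebra)) := map_nonneg ρ h0
  have h4 := ContinuousLinearMap.norm_sub_apply_sq_le h3 (C := 1) (by rwa [sub_zero]) ξ
  rw [dist_eq_norm]
  refine lt_of_pow_lt_pow_left₀ 2 hε.le (lt_of_le_of_lt ?_ hlt)
  have h5 : ξ - ρ (u : hΓ.algebra) ξ = ρ (1 - (u : hΓ.algebra)) ξ := by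
    rw [map_sub ρ, _root_.map_one ρ]; rfl
  rw [h5]
  rw [_root_.zero_apply, sub_zero, inner_zero_right, Complex.zero_re, sub_zero, one_mul] at h4
  exact h4

end Representation

/-- The endomorphism of the dilation. -/
theorem exists_endomorphism (hΓ : IsWordFamily τ Γ) (hτ : IsNormalUCP τ) :
    ∃ θ : hΓ.algebra →⋆ₐ[ℂ] hΓ.algebra, ScottContinuous θ ∧ ∀ (b : hΓ.algebra) (x y : List A),
      (Γ x).adjoint ∘L (θ b : K →L[ℂ] K) ∘L Γ y =
        ((star (x.headD 1) * τ ⟨_, hΓ.mem_algebra_iff.1 b.2 x.tail y.tail⟩ * y.headD 1 : A) :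
          H →L[ℂ] H) := by
  have hpos := isPosKernel_compress τ hΓ.incl hΓ.compress_mem
  obtain ⟨L, _, _, _, Λ, ρ, hΛ, hk, hρ⟩ := exists_stinespring
    (((VonNeumannAlgebra.toStarSubalgebra A).subtype.toAlgHom.toLinearMap ∘ₗ τ.toLinearMap) ∘ₗ
      compressₗ hΓ.incl hΓ.compress_mem) hpos
  have hk : ∀ a b, (Λ a).adjoint ∘L Λ b =
      (τ (compressₗ hΓ.incl hΓ.compress_mem (star a * b)) : H →L[ℂ] H) := hk
  obtain ⟨U, hU⟩ := hΓ.exists_wordIsometry hk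
  let W : K ≃ₗᵢ[ℂ] L := LinearIsometryEquiv.ofSurjective U
    (hΓ.surjective_wordIsometry hτ hΛ hk hρ hU)
  have hW : ∀ x v, W (Γ x v) = Λ (hΓ.word x.tail) (((x.headD 1 : A) : H →L[ℂ] H) v) :=
    fun x v => congrArg (fun T : H →L[ℂ] L => T v) (hU x)
  let σ : (L →L[ℂ] L) →⋆ₐ[ℂ] K →L[ℂ] K :=
    StarAlgHomClass.toStarAlgHom W.symm.conjStarAlgEquiv
  have hσ : ∀ T ξ, σ T ξ = W.symm (T (W ξ)) := fun _ _ => rfl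
  have hinner : ∀ T ξ η, ⟪ξ, σ T η⟫_ℂ = ⟪W ξ, T (W η)⟫_ℂ := fun T ξ η => by
    rw [hσ, ← W.inner_map_map, W.apply_symm_apply]
  have hform : ∀ (b : hΓ.algebra) (x y : List A), (Γ x).adjoint ∘L σ (ρ b) ∘L Γ y =
        ((star (x.headD 1) * τ ⟨_, hΓ.mem_algebra_iff.1 b.2 x.tail y.tail⟩ * y.headD 1 : A) :
          H →L[ℂ] H) := fun b x y => by
    ext v
    refine ext_inner_left ℂ fun w => ?_
    have h1 : (⟨_, hΓ.mem_algebra_iff.1 b.2 x.tail y.tail⟩ : A) =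
        compressₗ hΓ.incl hΓ.compress_mem (star (hΓ.word x.tail) * (b * hΓ.word y.tail)) := by
      rw [← mul_assoc]
      exact Subtype.ext (hΓ.compress_star_mul_mul _ _ b).symm
    rw [h1, ContinuousLinearMap.comp_apply, ContinuousLinearMap.adjoint_inner_right,
      ContinuousLinearMap.comp_apply, hinner, hW, hW]
    change _ = ⟪w, (((x.headD 1 : A) : H →L[ℂ] H).adjoint ∘L ((τ _ : A) : H →L[ℂ] H) ∘L
      ((y.headD 1 : A) : H →L[ℂ] H)) v⟫_ℂ
    rw [← hk, ← hρ, ContinuousLinearMap.comp_apply, ContinuousLinearMap.adjoint_inner_right,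
      ContinuousLinearMap.comp_apply, ContinuousLinearMap.comp_apply,
      ContinuousLinearMap.adjoint_inner_right]
    rfl
  -- The coefficients of the transported operator are built from A and τ, so it stays in the
  -- algebra.
  have hmem : ∀ b, σ (ρ b) ∈ hΓ.algebra := fun b => hΓ.mem_algebra_iff.2 fun x y => by
    rw [hform]; exact Subtype.prop _
  let θ : hΓ.algebra →⋆ₐ[ℂ] hΓ.algebra :=
    StarAlgHom.codRestrict (σ.comp ρ) hΓ.algebra.toStarSubalgebra hmem
  refine ⟨θ, fun D hne hD d hd => ?_, hform⟩
  have hmono : Monotone θ := OrderHomClass.mono θ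
  have hdir : DirectedOn (· ≤ ·) (θ '' D) := by
    rintro _ ⟨a, ha, rfl⟩ _ ⟨b, hb, rfl⟩
    obtain ⟨e, he, hae, hbe⟩ := hD a ha b hb
    exact ⟨θ e, ⟨e, he, rfl⟩, hmono hae, hmono hbe⟩
  rw [VonNeumannAlgebra.isLUB_iff _ hne hD] at hd
  rw [VonNeumannAlgebra.isLUB_iff _ (hne.image θ) hdir]
  refine ⟨?_, fun ξ ε hε => ?_⟩
  · rintro _ ⟨b, hb, rfl⟩
    exact hmono (hd.1 hb)
  · obtain ⟨b, hb, hlt⟩ := hΓ.exists_inner_lt hτ hΛ hk hρ hne hD hd.1 hd.2 (W ξ) hε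
    refine ⟨θ b, ⟨b, hb, rfl⟩, ?_⟩
    rw [← map_sub]
    change (⟪ξ, σ (ρ (d - b)) ξ⟫_ℂ).re < ε
    rwa [hinner]

end IsWordFamily

end WordSpace

/-! ### Existence of the minimal dilation -/

section Existence

variable {H : Type u} [NormedAddCommGroup H] [InnerProductSpace ℂ H] [CompleteSpace H]
  {A : VonNeumannAlgebra H} {τ : A →CP A}
  {K : Type u} [NormedAddCommGroup K] [InnerProductSpace ℂ K] [CompleteSpace K]
  {Γ : List A → H →L[ℂ] K}

namespace IsWordFamily

theorem inflate_mem (hΓ : IsWordFamily τ Γ) (a : A) : inflate hΓ.incl a ∈ hΓ.algebra := by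
  refine hΓ.mem_algebra_iff.2 fun x y => ?_
  have h : (Γ x).adjoint ∘L inflate hΓ.incl a ∘L Γ y =
      ((Γ x).adjoint ∘L Γ []) ∘L (a : H →L[ℂ] H) ∘L ((Γ []).adjoint ∘L Γ y) := by
    change (Γ x).adjoint ∘L (Γ [] ∘L (a : H →L[ℂ] H) ∘L (Γ []).adjoint) ∘L Γ y = _
    simp only [ContinuousLinearMap.comp_assoc]
  rw [h, hΓ.kernel, hΓ.kernel]
  exact (wordKernel τ x [] * (a * wordKernel τ [] y)).2

/-- The inclusion of `A` into the algebra of the dilation. -/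
def inclAlgebra (hΓ : IsWordFamily τ Γ) (a : A) : hΓ.algebra :=
  ⟨inflate hΓ.incl a, hΓ.inflate_mem a⟩

theorem inflate_comp (hΓ : IsWordFamily τ Γ) (a : H →L[ℂ] H) :
    inflate hΓ.incl a ∘L Γ [] = Γ [] ∘L a := by
  change (Γ [] ∘L a ∘L (Γ []).adjoint) ∘L Γ [] = _
  simp only [ContinuousLinearMap.comp_assoc]
  rw [hΓ.adjoint_comp_nil, ContinuousLinearMap.comp_id]

theorem adjoint_comp_inflate (hΓ : IsWordFamily τ Γ) (a : H →L[ℂ] H) :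
    (Γ []).adjoint ∘L inflate hΓ.incl a = a ∘L (Γ []).adjoint := by
  change (Γ []).adjoint ∘L Γ [] ∘L a ∘L (Γ []).adjoint = _
  rw [← ContinuousLinearMap.comp_assoc, hΓ.adjoint_comp_nil, ContinuousLinearMap.id_comp]

theorem compress_inclAlgebra (hΓ : IsWordFamily τ Γ) (a : A) :
    compressₗ hΓ.incl hΓ.compress_mem (hΓ.inclAlgebra a) = a := by
  refine Subtype.ext ?_
  change (Γ []).adjoint ∘L inflate hΓ.incl a ∘L Γ [] = _
  rw [hΓ.inflate_comp, ← ContinuousLinearMap.comp_assoc, hΓ.adjoint_comp_nil,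
    ContinuousLinearMap.id_comp]

variable (hΓ : IsWordFamily τ Γ) {θ : hΓ.algebra →⋆ₐ[ℂ] hΓ.algebra}

/-- The matrix coefficients of `θ` with respect to `Γ` come from those of the shorter words by `τ`. -/
def IsShift (hΓ : IsWordFamily τ Γ) (θ : hΓ.algebra →⋆ₐ[ℂ] hΓ.algebra) : Prop :=
  ∀ (b : hΓ.algebra) (x y : List A),
    (Γ x).adjoint ∘L (θ b : K →L[ℂ] K) ∘L Γ y =
      ((star (x.headD 1) * τ ⟨_, hΓ.mem_algebra_iff.1 b.2 x.tail y.tail⟩ * y.headD 1 : A) :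
        H →L[ℂ] H)

theorem compress_endomorphism (hθ : hΓ.IsShift θ) (b : hΓ.algebra) :
    compressₗ hΓ.incl hΓ.compress_mem (θ b) = τ (compressₗ hΓ.incl hΓ.compress_mem b) := by
  refine Subtype.ext ((hθ b [] []).trans ?_)
  simp only [List.headD_nil, star_one, one_mul, mul_one]
  rfl

/-- θ acts on tails: the coefficients of θ(b) are those of b on tails, fed through τ, which is the
recursion of the word kernel. -/
theorem endomorphism_comp_cons (hθ : hΓ.IsShift θ) {b : hΓ.algebra} {x y : List A}
    (h : (b : K →L[ℂ] K) ∘L Γ x = Γ y) (a : A) :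
    (θ b : K →L[ℂ] K) ∘L Γ (a :: x) = Γ (a :: y) := by
  refine hΓ.total.eq_of_adjoint_comp fun z => ?_
  rw [hθ, hΓ.kernel, wordKernel_eq hΓ.map_one]
  refine congrArg (fun t : A => ((star (z.headD 1) * τ t * a : A) : H →L[ℂ] H)) (Subtype.ext ?_)
  change (Γ z.tail).adjoint ∘L (b : K →L[ℂ] K) ∘L Γ x = _
  rw [h, hΓ.kernel]
  rfl

/-- The length must be exactly n: peeling off n letters leaves the empty word, where a acts on H
itself. -/
theorem iterate_comp (hθ : hΓ.IsShift θ) (a : A) : ∀ (n : ℕ) (x : List A), x.length = n →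
    ((θ^[n] (hΓ.inclAlgebra a) : hΓ.algebra) : K →L[ℂ] K) ∘L Γ x = Γ (x ++ [a])
  | 0, x, hx => by
    rw [List.length_eq_zero_iff.1 hx]
    change inflate hΓ.incl a ∘L Γ [] = _
    rw [hΓ.inflate_comp, hΓ.comp_eq]
    simp
  | n + 1, [], hx => by simp at hx
  | n + 1, b :: x, hx => by
    rw [Function.iterate_succ_apply']
    exact hΓ.endomorphism_comp_cons hθ (iterate_comp hθ a n x (by simpa using hx)) b

theorem dilationWord_eq (hθ : hΓ.IsShift θ) (x : ℕ → A) (h : H) : ∀ n,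
    dilationWord hΓ.incl θ hΓ.inclAlgebra x h n =
      Γ (1 :: (List.range n).map fun i => x (i + 1)) h
  | 0 => by
    have h1 := hΓ.comp_eq [] 1
    rw [List.headD_nil, one_mul, List.tail_nil] at h1
    exact congrArg (fun T : H →L[ℂ] K => T h) h1
  | n + 1 => by
    have h1 := hΓ.iterate_comp hθ (x (n + 1)) (n + 1)
      (1 :: (List.range n).map fun i => x (i + 1)) (by simp)
    rw [dilationWord, dilationWord_eq hθ x h n, List.range_succ, List.map_append]
    exact congrArg (fun T : H →L[ℂ] K => T h) h1

theorem exists_dilationWord (hθ : hΓ.IsShift θ) (x : List A) (h : H) :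
    ∃ (n : ℕ) (y : ℕ → A) (k : H),
    Γ x h = dilationWord hΓ.incl θ hΓ.inclAlgebra y k n := by
  cases x with
  | nil => exact ⟨0, fun _ => 1, h, rfl⟩
  | cons a x =>
    -- The first letter is absorbed into the vector; dilation words number their letters from 1,
    -- hence the shift.
    refine ⟨x.length, fun i => x.getD (i - 1) 1, (a : H →L[ℂ] H) h, ?_⟩
    have h1 : ((List.range x.length).map fun i => x.getD (i + 1 - 1) 1) = x :=
      List.ext_getElem (by simp) fun i h1 h2 => by simp [h2]
    have h2 := hΓ.comp_eq (1 :: x) a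
    rw [List.headD_cons, List.tail_cons, one_mul] at h2
    rw [hΓ.dilationWord_eq hθ, h1, ← h2]
    rfl

/-- Let c commute with C. It commutes with p and with A, so its corner t on H lies in A'. Appending
letters by means of θⁿ(a) gives cΓx = Γx t for all words, so c is a lift of t and commutes with the
algebra. -/
theorem algebra_le (hθ : hΓ.IsShift θ) {C : VonNeumannAlgebra K}
    (hC : ∀ (n : ℕ) (a : A), ((θ^[n] (hΓ.inclAlgebra a) : hΓ.algebra) : K →L[ℂ] K) ∈ C) :
    hΓ.algebra ≤ C := by
  intro b hb
  rw [← C.commutant_commutant, VonNeumannAlgebra.mem_commutant_iff]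
  intro c hc
  have hcomm : ∀ (n : ℕ) (a : A),
      ((θ^[n] (hΓ.inclAlgebra a) : hΓ.algebra) : K →L[ℂ] K) ∘L c =
        c ∘L ((θ^[n] (hΓ.inclAlgebra a) : hΓ.algebra) : K →L[ℂ] K) :=
    fun n a => VonNeumannAlgebra.mem_commutant_iff.1 hc _ (hC n a)
  have h0 : ∀ a : A, inflate hΓ.incl a ∘L c = c ∘L inflate hΓ.incl a := hcomm 0
  refine (mem_familyAlgebra_iff_commute hΓ.total hΓ.kernel_mem).1 hb c
    ⟨(Γ []).adjoint ∘L c ∘L Γ [], ?_, fun x => ?_⟩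
  · rw [VonNeumannAlgebra.mem_commutant_iff]
    intro a ha
    have h1 := h0 ⟨a, ha⟩
    change a ∘L (Γ []).adjoint ∘L c ∘L Γ [] = ((Γ []).adjoint ∘L c ∘L Γ []) ∘L a
    rw [← ContinuousLinearMap.comp_assoc, ← hΓ.adjoint_comp_inflate, ContinuousLinearMap.comp_assoc,
      ContinuousLinearMap.comp_assoc, ContinuousLinearMap.comp_assoc, ← hΓ.inflate_comp,
      ← ContinuousLinearMap.comp_assoc c, ← h1, ContinuousLinearMap.comp_assoc]
  · induction x using List.reverseRecOn with
    | nil =>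
      have h2 : inflate hΓ.incl ((1 : A) : H →L[ℂ] H) = Γ [] ∘L (Γ []).adjoint := rfl
      have h1 := h0 1
      rw [h2] at h1
      rw [← ContinuousLinearMap.comp_assoc, ← ContinuousLinearMap.comp_assoc, h1,
        ContinuousLinearMap.comp_assoc, ContinuousLinearMap.comp_assoc, hΓ.adjoint_comp_nil,
        ContinuousLinearMap.comp_id]
    | append_singleton x a ih =>
      rw [← hΓ.iterate_comp hθ a x.length x rfl, ← ContinuousLinearMap.comp_assoc, ← hcomm,
        ContinuousLinearMap.comp_assoc, ih, ContinuousLinearMap.comp_assoc]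

theorem isMinimalDilation (hθ : hΓ.IsShift θ) (hn : ScottContinuous θ) :
    IsMinimalDilation τ hΓ.incl hΓ.algebra θ where
  inflate_mem := hΓ.inflate_mem
  compress_mem := hΓ.compress_mem
  normal := hn
  dilation n a := by
    have h1 : Function.Semiconj (compressₗ hΓ.incl hΓ.compress_mem) θ τ :=
      hΓ.compress_endomorphism hθ
    have h2 := h1.iterate_right n (hΓ.inclAlgebra a)
    rw [hΓ.compress_inclAlgebra] at h2
    exact (congrArg Subtype.val h2).symm
  space_minimal := by
    rw [eq_top_iff, ← hΓ.total]
    refine Submodule.topologicalClosure_mono (Submodule.span_mono ?_)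
    rintro _ ⟨x, h, rfl⟩
    exact hΓ.exists_dilationWord hθ x h
  algebra_minimal := ⟨fun _ _ => Subtype.prop _, fun _ hC => hΓ.algebra_le hθ hC⟩

end IsWordFamily

theorem exists_isMinimalDilation (hτ : IsNormalUCP τ) :
    ∃ (K : Type u) (_ : NormedAddCommGroup K) (_ : InnerProductSpace ℂ K) (_ : CompleteSpace K)
      (V : H →ₗᵢ[ℂ] K) (B : VonNeumannAlgebra K) (θ : B →⋆ₐ[ℂ] B), IsMinimalDilation τ V B θ := by
  obtain ⟨K, _, _, _, Γ, hΓ, hk⟩ := (isPosKernel_wordKernel hτ.map_one).exists_family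
  have hw : IsWordFamily τ Γ := ⟨hτ.map_one, hΓ, hk⟩
  obtain ⟨θ, hn, hθ⟩ := hw.exists_endomorphism hτ
  exact ⟨K, _, _, _, hw.incl, hw.algebra, θ, hw.isMinimalDilation hθ hn⟩

end Existence

/-! ### Recurrence of peripheral eigenvalues -/

section Recurrence

open Filter Topology

/-- There is a filter along which the powers of all complex numbers of modulus one converge
to `1`. -/
theorem exists_filter_tendsto_pow_one :
    ∃ F : Filter ℕ, F.NeBot ∧ F ≤ atTop ∧ ∀ c : ℂ, ‖c‖ = 1 → Tendsto (fun n => c ^ n) F (𝓝 1) := by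
  -- In the compact group of all functions Circle → Circle the powers of the identity function
  -- cluster at 1, which treats all c simultaneously.
  have h := mapClusterPt_one_atTop_pow (fun c : Circle => c)
  obtain ⟨F, hF, hle, ht⟩ : ∃ F : Filter ℕ, F.NeBot ∧ F ≤ atTop ∧
      Tendsto (fun n : ℕ => (fun c : Circle => c) ^ n) F (𝓝 1) := by
    rw [mapClusterPt_iff_ultrafilter] at h
    obtain ⟨U, hU, ht⟩ := h
    exact ⟨U, inferInstance, hU, ht⟩
  refine ⟨F, hF, hle, fun c hc => ?_⟩
  have h1 := (tendsto_pi_nhds.1 ht) ⟨c, mem_sphere_zero_iff_norm.2 hc⟩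
  exact ((by fun_prop : Continuous ((↑) : Circle → ℂ)).tendsto _).comp h1

variable {M : Type*} [CStarAlgebra M]

theorem tendsto_iterate_of_mem_span {F : Filter ℕ}
    (hF : ∀ c : ℂ, ‖c‖ = 1 → Tendsto (fun n => c ^ n) F (𝓝 1)) (φ : M →ₗ[ℂ] M) {z : M}
    (hz : z ∈ Submodule.span ℂ (peripheralEigenvectors φ)) :
    Tendsto (fun n => (φ ^ n) z) F (𝓝 z) := by
  induction hz using Submodule.span_induction with
  | mem x hx =>
    obtain ⟨c, hc, hx⟩ := hx
    have h1 : ∀ n, (φ ^ n) x = c ^ n • x := fun n => by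
      induction n with
      | zero => simp
      | succ n ih => rw [pow_succ', Module.End.mul_apply, ih, map_smul, hx, smul_smul, pow_succ]
    simp_rw [h1]
    simpa using (hF c hc).smul_const x
  | zero => simpa using tendsto_const_nhds
  | add x y _ _ hx hy => simpa using hx.add hy
  | smul c x _ hx => simpa using hx.const_smul c

theorem exists_iterate_eq_of_mem_span (φ : M →ₗ[ℂ] M) (n : ℕ) {z : M}
    (hz : z ∈ Submodule.span ℂ (peripheralEigenvectors φ)) :
    ∃ w ∈ Submodule.span ℂ (peripheralEigenvectors φ), (φ ^ n) w = z := by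
  have h : Submodule.span ℂ (peripheralEigenvectors φ) ≤
      (Submodule.span ℂ (peripheralEigenvectors φ)).map (φ ^ n) := by
    rw [Submodule.span_le]
    rintro x ⟨c, hc, hx⟩
    have hc0 : c ≠ 0 := by rintro rfl; simp at hc
    have h1 : ∀ n, (φ ^ n) x = c ^ n • x := fun n => by
      induction n with
      | zero => simp
      | succ n ih => rw [pow_succ', Module.End.mul_apply, ih, map_smul, hx, smul_smul, pow_succ]
    refine ⟨(c ^ n)⁻¹ • x, Submodule.smul_mem _ _ (Submodule.subset_span ⟨c, hc, hx⟩), ?_⟩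
    rw [map_smul, h1, smul_smul, inv_mul_cancel₀ (pow_ne_zero n hc0), one_smul]
  exact h hz

end Recurrence

section Iterate

variable {M : Type*} [CStarAlgebra M]

/-- The iterates of a star-endomorphism as star-endomorphisms. -/
def StarAlgHom.iter (θ : M →⋆ₐ[ℂ] M) : ℕ → M →⋆ₐ[ℂ] M
  | 0 => .id ℂ M
  | n + 1 => θ.comp (StarAlgHom.iter θ n)

theorem StarAlgHom.iter_apply (θ : M →⋆ₐ[ℂ] M) (n : ℕ) (x : M) : θ.iter n x = θ^[n] x := by
  induction n with
  | zero => rfl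
  | succ n ih => rw [Function.iterate_succ_apply', ← ih]; rfl

theorem StarAlgHom.iter_add (θ : M →⋆ₐ[ℂ] M) (m n : ℕ) (x : M) :
    θ.iter (m + n) x = θ.iter m (θ.iter n x) := by
  simp only [iter_apply, Function.iterate_add_apply]

theorem StarAlgHom.endoLinear_pow (θ : M →⋆ₐ[ℂ] M) (n : ℕ) (x : M) :
    (endoLinear θ ^ n) x = θ.iter n x := by
  rw [Module.End.pow_apply, StarAlgHom.iter_apply]; rfl

theorem StarAlgHom.norm_iter_le (θ : M →⋆ₐ[ℂ] M) (n : ℕ) (z : M) : ‖θ.iter n z‖ ≤ ‖z‖ :=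
  NonUnitalStarAlgHom.norm_apply_le (θ.iter n) z

end Iterate

/-! ### The increasing projections θⁿ(p) of a minimal dilation -/

namespace IsMinimalDilation

open Filter Topology

variable {H : Type u} [NormedAddCommGroup H] [InnerProductSpace ℂ H] [CompleteSpace H]
  {A : VonNeumannAlgebra H} {τ : A →CP A}
  {K : Type v} [NormedAddCommGroup K] [InnerProductSpace ℂ K] [CompleteSpace K]
  {V : H →ₗᵢ[ℂ] K} {B : VonNeumannAlgebra K} {θ : B →⋆ₐ[ℂ] B}

/-- The inclusion of `A` into the algebra of a dilation. -/
def incl (h : IsMinimalDilation τ V B θ) (a : A) : B := ⟨inflate V a, h.inflate_mem a⟩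

/-- The compression of the algebra of a dilation onto `A`. -/
def expect (h : IsMinimalDilation τ V B θ) : B →ₗ[ℂ] A := compressₗ V h.compress_mem

/-- The projection `θⁿ(p)`. -/
def proj (h : IsMinimalDilation τ V B θ) (n : ℕ) : B := θ.iter n (h.incl 1)

theorem adjoint_comp_self (V : H →ₗᵢ[ℂ] K) :
    V.toContinuousLinearMap.adjoint ∘L V.toContinuousLinearMap = .id ℂ H := by
  ext x
  refine ext_inner_left ℂ fun y => ?_
  rw [ContinuousLinearMap.comp_apply, ContinuousLinearMap.adjoint_inner_right]
  exact V.inner_map_map y x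

theorem adjoint_comp_self_comp (V : H →ₗᵢ[ℂ] K) {E : Type*} [NormedAddCommGroup E]
    [NormedSpace ℂ E] (T : E →L[ℂ] H) :
    V.toContinuousLinearMap.adjoint ∘L V.toContinuousLinearMap ∘L T = T := by
  rw [← ContinuousLinearMap.comp_assoc, adjoint_comp_self, ContinuousLinearMap.id_comp]

variable (h : IsMinimalDilation τ V B θ)

theorem incl_mul (a b : A) : h.incl (a * b) = h.incl a * h.incl b := by
  refine Subtype.ext ?_
  change inflate V ((a : H →L[ℂ] H) ∘L (b : H →L[ℂ] H)) = inflate V a ∘L inflate V b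
  simp only [inflate, ContinuousLinearMap.comp_assoc, adjoint_comp_self_comp]

theorem incl_smul (c : ℂ) (a : A) : h.incl (c • a) = c • h.incl a := by
  refine Subtype.ext ?_
  change inflate V (c • (a : H →L[ℂ] H)) = c • inflate V a
  simp only [inflate, ContinuousLinearMap.smul_comp, ContinuousLinearMap.comp_smul]

theorem star_incl (a : A) : star (h.incl a) = h.incl (star a) := by
  refine Subtype.ext ?_
  change (inflate V a).adjoint = inflate V (a : H →L[ℂ] H).adjoint
  simp only [inflate, ContinuousLinearMap.adjoint_comp, ContinuousLinearMap.adjoint_adjoint,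
    ContinuousLinearMap.comp_assoc]

theorem norm_incl_le (a : A) : ‖h.incl a‖ ≤ ‖a‖ := by
  have hV : ‖V.toContinuousLinearMap‖ ≤ 1 := V.norm_toContinuousLinearMap_le
  have hV' : ‖V.toContinuousLinearMap.adjoint‖ ≤ 1 := by rwa [LinearIsometryEquiv.norm_map]
  calc ‖inflate V a‖ ≤ ‖V.toContinuousLinearMap‖ *
        (‖(a : H →L[ℂ] H)‖ * ‖V.toContinuousLinearMap.adjoint‖) :=
      (ContinuousLinearMap.opNorm_comp_le _ _).trans
        (mul_le_mul_of_nonneg_left (ContinuousLinearMap.opNorm_comp_le _ _) (norm_nonneg _))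
    _ ≤ 1 * (‖(a : H →L[ℂ] H)‖ * 1) := by gcongr
    _ = ‖a‖ := by rw [one_mul, mul_one]; rfl

theorem norm_expect_le (z : B) : ‖h.expect z‖ ≤ ‖z‖ := by
  have hV : ‖V.toContinuousLinearMap‖ ≤ 1 := V.norm_toContinuousLinearMap_le
  have hV' : ‖V.toContinuousLinearMap.adjoint‖ ≤ 1 := by rwa [LinearIsometryEquiv.norm_map]
  calc ‖compress V z‖ ≤ ‖V.toContinuousLinearMap.adjoint‖ *
        (‖(z : K →L[ℂ] K)‖ * ‖V.toContinuousLinearMap‖) :=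
      (ContinuousLinearMap.opNorm_comp_le _ _).trans
        (mul_le_mul_of_nonneg_left (ContinuousLinearMap.opNorm_comp_le _ _) (norm_nonneg _))
    _ ≤ 1 * (‖(z : K →L[ℂ] K)‖ * 1) := by gcongr
    _ = ‖z‖ := by rw [one_mul, mul_one]; rfl

theorem expect_incl (a : A) : h.expect (h.incl a) = a := by
  refine Subtype.ext ?_
  change compress V (inflate V a) = a
  simp only [compress, inflate, ContinuousLinearMap.comp_assoc, adjoint_comp_self_comp]
  rw [adjoint_comp_self, ContinuousLinearMap.comp_id]

theorem incl_expect (z : B) : h.incl (h.expect z) = h.incl 1 * z * h.incl 1 := by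
  refine Subtype.ext ?_
  change inflate V (compress V z) = (inflate V (.id ℂ H) ∘L (z : K →L[ℂ] K)) ∘L inflate V (.id ℂ H)
  simp only [inflate, compress, ContinuousLinearMap.comp_assoc, ContinuousLinearMap.id_comp]

theorem expect_incl_one_mul (z : B) : h.expect (h.incl 1 * z * h.incl 1) = h.expect z := by
  rw [← incl_expect, expect_incl]

theorem iterate_eq (n : ℕ) (a : A) : τ^[n] a = h.expect (θ.iter n (h.incl a)) := by
  rw [StarAlgHom.iter_apply]
  exact Subtype.ext (h.dilation n a)

theorem incl_one_mul_self : h.incl 1 * h.incl 1 = h.incl 1 := by rw [← incl_mul, mul_one]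

theorem eq_zero_of_expect {q : B} (hq : h.expect (star q * q) = 0) : q * h.incl 1 = 0 := by
  rw [← CStarRing.star_mul_self_eq_zero_iff, star_mul, star_incl, star_one, mul_assoc,
    ← mul_assoc (star q), ← mul_assoc, ← incl_expect, hq]
  exact Subtype.ext (by change inflate V 0 = 0; simp [inflate])

theorem expect_one : h.expect 1 = 1 := Subtype.ext (adjoint_comp_self V)

/-- This is p ≤ θ(p): τ(1) = 1 says p(1 - θ(p))p = 0, and 1 - θ(p) is a projection. -/
theorem endomorphism_incl_one_mul (hτ : τ 1 = 1) : θ (h.incl 1) * h.incl 1 = h.incl 1 := by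
  have hq : star (1 - θ (h.incl 1)) * (1 - θ (h.incl 1)) = 1 - θ (h.incl 1) := by
    rw [star_sub, star_one, ← map_star, star_incl, star_one, mul_sub, mul_one, sub_mul, one_mul,
      ← map_mul, incl_one_mul_self, sub_self, sub_zero]
  have h1 := h.iterate_eq 1 1
  have h2 := h.eq_zero_of_expect (q := 1 - θ (h.incl 1)) (by
    rw [hq, map_sub, expect_one]
    change 1 - h.expect (θ.iter 1 (h.incl 1)) = 0
    rw [← h1, Function.iterate_one, hτ, sub_self])
  rw [sub_mul, one_mul, sub_eq_zero] at h2
  exact h2.symm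

theorem star_proj (n : ℕ) : star (h.proj n) = h.proj n := by
  rw [proj, ← map_star, star_incl, star_one]

theorem incl_one_mul_endomorphism (hτ : τ 1 = 1) : h.incl 1 * θ (h.incl 1) = h.incl 1 := by
  have h1 := congrArg star (h.endomorphism_incl_one_mul hτ)
  rwa [star_mul, ← map_star, star_incl, star_one] at h1

/-- The dilation property speaks only of A. It extends to B because p ≤ θ(p) gives pθ(z)p =
pθ(pzp)p. -/
theorem expect_endomorphism (hτ : τ 1 = 1) (z : B) : h.expect (θ z) = τ (h.expect z) := by
  have h1 := h.iterate_eq 1 (h.expect z)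
  rw [Function.iterate_one] at h1
  rw [h1, incl_expect, ← h.expect_incl_one_mul (θ z)]
  change _ = h.expect (θ (h.incl 1 * z * h.incl 1))
  rw [← h.expect_incl_one_mul (θ (h.incl 1 * z * h.incl 1)), map_mul θ, map_mul θ]
  congr 1
  calc h.incl 1 * θ z * h.incl 1
      = h.incl 1 * θ (h.incl 1) * θ z * (θ (h.incl 1) * h.incl 1) := by
        rw [h.incl_one_mul_endomorphism hτ, h.endomorphism_incl_one_mul hτ]
    _ = _ := by simp only [mul_assoc]

theorem expect_iter (hτ : τ 1 = 1) (n : ℕ) (z : B) : h.expect (θ.iter n z) = τ^[n] (h.expect z) := by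
  rw [StarAlgHom.iter_apply]
  exact (Function.Semiconj.iterate_right (f := h.expect) (h.expect_endomorphism hτ) n) z

theorem norm_iterate_le (h : IsMinimalDilation τ V B θ) (n : ℕ) (a : A) : ‖τ^[n] a‖ ≤ ‖a‖ := by
  rw [h.iterate_eq]
  exact (h.norm_expect_le _).trans ((θ.norm_iter_le _ _).trans (h.norm_incl_le a))

theorem proj_mul_self (n : ℕ) : h.proj n * h.proj n = h.proj n := by
  rw [proj, ← map_mul, incl_one_mul_self]

theorem proj_mul_incl (n : ℕ) (a : A) :
    h.proj n * θ.iter n (h.incl a) = θ.iter n (h.incl a) := by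
  rw [proj, ← map_mul, ← incl_mul, one_mul]

theorem proj_succ_mul (hτ : τ 1 = 1) (n : ℕ) : h.proj (n + 1) * h.proj n = h.proj n := by
  rw [proj, proj, θ.iter_add n 1, ← map_mul]
  exact congrArg (θ.iter n) (h.endomorphism_incl_one_mul hτ)

theorem proj_mul_of_le (hτ : τ 1 = 1) {m n : ℕ} (hmn : m ≤ n) :
    h.proj n * h.proj m = h.proj m := by
  induction n, hmn using Nat.le_induction with
  | base => exact h.proj_mul_self m
  | succ n _ ih => rw [← ih, ← mul_assoc, h.proj_succ_mul hτ]

theorem iter_incl_expect (n : ℕ) (z : B) :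
    h.proj n * θ.iter n z * h.proj n = θ.iter n (h.incl (h.expect z)) := by
  rw [incl_expect, map_mul, map_mul]; rfl

theorem norm_proj_le (n : ℕ) : ‖h.proj n‖ ≤ 1 := by
  have h1 : ‖h.proj n‖ * ‖h.proj n‖ = ‖h.proj n‖ := by
    rw [← CStarRing.norm_star_mul_self, star_proj, proj_mul_self]
  by_contra hc
  nlinarith

theorem norm_proj_apply_le (n : ℕ) (ξ : K) : ‖(h.proj n : K →L[ℂ] K) ξ‖ ≤ ‖ξ‖ := by
  have := (h.proj n : K →L[ℂ] K).le_of_opNorm_le (h.norm_proj_le n) ξ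
  rwa [one_mul] at this

theorem proj_apply_dilationWord (n : ℕ) (x : ℕ → A) (k : H) :
    (h.proj n : K →L[ℂ] K) (dilationWord V θ h.incl x k n) = dilationWord V θ h.incl x k n := by
  cases n with
  | zero =>
    change inflate V (.id ℂ H) (V k) = V k
    have := adjoint_comp_self V
    exact congrArg (fun T : H →L[ℂ] H => V (T k)) this
  | succ n =>
    have h1 := h.proj_mul_incl (n + 1) (x (n + 1))
    rw [StarAlgHom.iter_apply] at h1
    exact congrArg (fun T : B => (T : K →L[ℂ] K) (dilationWord V θ h.incl x k n)) h1

/-- The projections `θⁿ(p)` increase strongly to the identity. -/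
theorem tendsto_proj (hτ : τ 1 = 1) (ξ : K) :
    Tendsto (fun n => (h.proj n : K →L[ℂ] K) ξ) atTop (𝓝 ξ) := by
  let W : Submodule ℂ K :=
    { carrier := {ξ | Tendsto (fun n => (h.proj n : K →L[ℂ] K) ξ) atTop (𝓝 ξ)}
      zero_mem' := by simp
      add_mem' := fun {ξ η} hξ hη =>
        (Tendsto.add (Set.mem_ofPred.1 hξ) (Set.mem_ofPred.1 hη)).congr
          fun b => (map_add _ _ _).symm
      smul_mem' := fun c ξ hξ =>
        (Tendsto.const_smul (Set.mem_ofPred.1 hξ) c).congr fun b => (map_smul _ _ _).symm }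
  have hW : W.topologicalClosure ≤ W := by
    intro ξ hξ
    refine Metric.tendsto_nhds.2 fun δ hδ => ?_
    obtain ⟨η, hη, hd⟩ := Metric.mem_closure_iff.1 hξ (δ / 3) (by positivity)
    filter_upwards [Metric.tendsto_nhds.1 (Set.mem_ofPred.1 hη) (δ / 3) (by positivity)] with n hn
    have h1 : dist ((h.proj n : K →L[ℂ] K) ξ) ((h.proj n : K →L[ℂ] K) η) ≤ dist ξ η := by
      rw [dist_eq_norm, dist_eq_norm, ← map_sub]
      exact h.norm_proj_apply_le n _
    have h2 := dist_triangle4 ((h.proj n : K →L[ℂ] K) ξ) ((h.proj n : K →L[ℂ] K) η) η ξ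
    rw [dist_comm η ξ] at h2
    linarith
  have hmem : ξ ∈ (⊤ : Submodule ℂ K) := trivial
  rw [← h.space_minimal] at hmem
  refine hW (Submodule.topologicalClosure_mono (Submodule.span_le.2 ?_) hmem)
  rintro _ ⟨n, x, k, rfl⟩
  -- A dilation word of length n is fixed by pₙ, hence by every later projection.
  refine tendsto_atTop_of_eventually_const (i₀ := n) fun m hm => ?_
  have h1 := h.proj_apply_dilationWord n x k
  have h2 := h.proj_mul_of_le hτ hm
  change (h.proj m : K →L[ℂ] K) (dilationWord V θ h.incl x k n) = dilationWord V θ h.incl x k n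
  rw [← h1]
  exact congrArg (fun T : B => (T : K →L[ℂ] K) (dilationWord V θ h.incl x k n)) h2

theorem tendsto_proj_mul_proj (hτ : τ 1 = 1) (z : B) (ξ : K) :
    Tendsto (fun n => ((h.proj n * z * h.proj n : B) : K →L[ℂ] K) ξ) atTop
      (𝓝 ((z : K →L[ℂ] K) ξ)) := by
  have h1 : Tendsto (fun n => (z : K →L[ℂ] K) ((h.proj n : K →L[ℂ] K) ξ)) atTop
      (𝓝 ((z : K →L[ℂ] K) ξ)) := ((z : K →L[ℂ] K).continuous.tendsto _).comp (h.tendsto_proj hτ ξ)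
  have h2 : Tendsto (fun n => (h.proj n : K →L[ℂ] K) ((z : K →L[ℂ] K) ((h.proj n : K →L[ℂ] K) ξ)) -
      (h.proj n : K →L[ℂ] K) ((z : K →L[ℂ] K) ξ)) atTop (𝓝 0) := by
    refine squeeze_zero_norm (a := fun n => ‖(z : K →L[ℂ] K) ((h.proj n : K →L[ℂ] K) ξ) -
      (z : K →L[ℂ] K) ξ‖) (fun n => ?_) (tendsto_iff_norm_sub_tendsto_zero.1 h1)
    rw [← map_sub]
    exact h.norm_proj_apply_le n _
  have h3 := h2.add (h.tendsto_proj hτ ((z : K →L[ℂ] K) ξ))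
  rw [zero_add] at h3
  exact h3.congr fun n => sub_add_cancel _ _

theorem norm_le_of_forall_proj (hτ : τ 1 = 1) {z : B} {C : ℝ}
    (hz : ∀ n, ‖h.proj n * z * h.proj n‖ ≤ C) : ‖z‖ ≤ C := by
  refine ContinuousLinearMap.opNorm_le_bound _ ((norm_nonneg _).trans (hz 0)) fun ξ => ?_
  exact le_of_tendsto (h.tendsto_proj_mul_proj hτ z ξ).norm
    (Eventually.of_forall fun n => ContinuousLinearMap.le_of_opNorm_le _ (hz n) ξ)

/-- Indices start at 1 because applying θ to a compression by pₙ gives one by pₙ₊₁. -/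
theorem eq_of_forall_proj (hτ : τ 1 = 1) {z w : B}
    (hzw : ∀ n, h.proj (n + 1) * z * h.proj (n + 1) = h.proj (n + 1) * w * h.proj (n + 1)) :
    z = w := by
  refine Subtype.ext (ContinuousLinearMap.ext fun ξ => ?_)
  have h1 := (tendsto_add_atTop_iff_nat 1).2 (h.tendsto_proj_mul_proj hτ z ξ)
  have h2 := (tendsto_add_atTop_iff_nat 1).2 (h.tendsto_proj_mul_proj hτ w ξ)
  simp only [hzw] at h1
  exact tendsto_nhds_unique h1 h2

/-- A bounded sequence that is consistent under the compressions by the projections `θⁿ(p)` comes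
from an element of the algebra. -/
theorem exists_proj_eq (hτ : τ 1 = 1) {y : ℕ → B} {C : ℝ} (hC : ∀ n, ‖y n‖ ≤ C)
    (hy : ∀ m n, m ≤ n → h.proj m * y n * h.proj m = y m) :
    ∃ z : B, ∀ n, h.proj n * z * h.proj n = y n := by
  have hCn : 0 ≤ C := (norm_nonneg _).trans (hC 0)
  have hyC : ∀ n (ξ : K), ‖(y n : K →L[ℂ] K) ξ‖ ≤ C * ‖ξ‖ := fun n ξ =>
    ContinuousLinearMap.le_of_opNorm_le _ (hC n) ξ
  have hcomp : ∀ k m n, k ≤ m → m ≤ n → h.proj m * (y n * h.proj k) = y m * h.proj k := by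
    intro k m n hkm hmn
    rw [← hy m n hmn, mul_assoc (h.proj m * y n), h.proj_mul_of_le hτ hkm, mul_assoc]
  have hcauchy : ∀ k (ξ : K), CauchySeq fun n => (y n : K →L[ℂ] K) ((h.proj k : K →L[ℂ] K) ξ) := by
    intro k ξ
    obtain ⟨η, hη⟩ : ∃ η, η = (h.proj k : K →L[ℂ] K) ξ := ⟨_, rfl⟩
    rw [← hη]
    have hpy : ∀ m n, k ≤ m → m ≤ n →
        (h.proj m : K →L[ℂ] K) ((y n : K →L[ℂ] K) η) = (y m : K →L[ℂ] K) η := by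
      intro m n hkm hmn
      rw [hη]
      exact congrArg (fun T : B => (T : K →L[ℂ] K) ξ) (hcomp k m n hkm hmn)
    -- Since yₘη = pₘyₙη, increments are orthogonal to earlier terms; the bounded increasing norms
    -- then make the sequence Cauchy.
    have hpyth : ∀ m n, k ≤ m → m ≤ n → ‖(y n : K →L[ℂ] K) η - (y m : K →L[ℂ] K) η‖ ^ 2 =
        ‖(y n : K →L[ℂ] K) η‖ ^ 2 - ‖(y m : K →L[ℂ] K) η‖ ^ 2 := by
      intro m n hkm hmn
      have hsa : (h.proj m : K →L[ℂ] K).adjoint = h.proj m := congrArg Subtype.val (h.star_proj m)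
      have h1 : (⟪(y n : K →L[ℂ] K) η, (y m : K →L[ℂ] K) η⟫_ℂ) =
          ⟪(y m : K →L[ℂ] K) η, (y m : K →L[ℂ] K) η⟫_ℂ := by
        nth_rw 1 [← hpy m m hkm le_rfl]
        rw [← ContinuousLinearMap.adjoint_inner_left, hsa, hpy m n hkm hmn]
      rw [@norm_sub_sq ℂ, h1, inner_self_eq_norm_sq]
      ring
    have hbdd : BddAbove (Set.range fun n => ‖(y (n + k) : K →L[ℂ] K) η‖ ^ 2) := by
      refine ⟨(C * ‖η‖) ^ 2, ?_⟩
      rintro _ ⟨n, rfl⟩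
      exact pow_le_pow_left₀ (norm_nonneg _) (hyC _ η) 2
    have hmono : Monotone fun n => ‖(y (n + k) : K →L[ℂ] K) η‖ ^ 2 := by
      intro m n hmn
      have h1 := hpyth (m + k) (n + k) (Nat.le_add_left _ _) (Nat.add_le_add_right hmn k)
      have h2 := sq_nonneg ‖(y (n + k) : K →L[ℂ] K) η - (y (m + k) : K →L[ℂ] K) η‖
      beta_reduce
      linarith
    have hc := (tendsto_atTop_ciSup hmono hbdd).cauchySeq
    have hc2 : CauchySeq fun n => (y (n + k) : K →L[ℂ] K) η := by
      rw [Metric.cauchySeq_iff'] at hc ⊢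
      intro ε hε
      obtain ⟨N, hN⟩ := hc (ε ^ 2) (by positivity)
      refine ⟨N, fun n hn => ?_⟩
      have h1 := hN n hn
      rw [Real.dist_eq, ← hpyth (N + k) (n + k) (Nat.le_add_left _ _) (Nat.add_le_add_right hn k),
        abs_of_nonneg (sq_nonneg _)] at h1
      rw [dist_eq_norm]
      exact lt_of_pow_lt_pow_left₀ 2 hε.le h1
    obtain ⟨l, hl⟩ := cauchySeq_tendsto_of_complete hc2
    exact ((tendsto_add_atTop_iff_nat k).1 hl).cauchySeq
  have hlim : ∀ ξ : K, ∃ η, Tendsto (fun n => (y n : K →L[ℂ] K) ξ) atTop (𝓝 η) := by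
    intro ξ
    refine cauchySeq_tendsto_of_complete (Metric.cauchySeq_iff'.2 fun ε hε => ?_)
    obtain ⟨k, hk⟩ := (Metric.tendsto_nhds.1 (h.tendsto_proj hτ ξ) (ε / 3 / (C + 1))
      (by positivity)).exists
    obtain ⟨N, hN⟩ := Metric.cauchySeq_iff'.1 (hcauchy k ξ) (ε / 3) (by positivity)
    refine ⟨N, fun n hn => ?_⟩
    have h1 : ∀ n, dist ((y n : K →L[ℂ] K) ξ) ((y n : K →L[ℂ] K) ((h.proj k : K →L[ℂ] K) ξ)) <
        ε / 3 := fun n => by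
      rw [dist_eq_norm, ← map_sub]
      refine (hyC n _).trans_lt ?_
      rw [lt_div_iff₀ (by positivity), dist_comm, dist_eq_norm] at hk
      nlinarith [norm_nonneg (ξ - (h.proj k : K →L[ℂ] K) ξ)]
    have h2 := dist_triangle4_right ((y n : K →L[ℂ] K) ξ) ((y N : K →L[ℂ] K) ξ)
      ((y n : K →L[ℂ] K) ((h.proj k : K →L[ℂ] K) ξ)) ((y N : K →L[ℂ] K) ((h.proj k : K →L[ℂ] K) ξ))
    linarith [h1 n, h1 N, hN n hn]
  choose f hf using hlim
  have hbd : Bornology.IsBounded (Set.range fun n => (y n : K →L[ℂ] K)) := by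
    rw [isBounded_iff_forall_norm_le]
    exact ⟨C, by rintro _ ⟨n, rfl⟩; exact hC n⟩
  let s : K →L[ℂ] K := ContinuousLinearMap.ofTendstoOfBoundedRange f
    (fun n => (y n : K →L[ℂ] K)) (tendsto_pi_nhds.2 hf) hbd
  have hs : ∀ ξ, Tendsto (fun n => (y n : K →L[ℂ] K) ξ) atTop (𝓝 (s ξ)) := hf
  refine ⟨⟨s, B.mem_of_tendsto (fun n => (y n).2) hs⟩, fun n => ?_⟩
  refine Subtype.ext (ContinuousLinearMap.ext fun ξ => ?_)
  have h1 : Tendsto (fun m => (h.proj n : K →L[ℂ] K) ((y m : K →L[ℂ] K)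
      ((h.proj n : K →L[ℂ] K) ξ))) atTop (𝓝 ((h.proj n : K →L[ℂ] K) (s
      ((h.proj n : K →L[ℂ] K) ξ)))) := ((h.proj n : K →L[ℂ] K).continuous.tendsto _).comp (hs _)
  refine tendsto_nhds_unique h1 (tendsto_atTop_of_eventually_const (i₀ := n) fun m hm => ?_)
  exact congrArg (fun T : B => (T : K →L[ℂ] K) ξ) (hy n m hm)

end IsMinimalDilation

/-! ### The compression of peripheral spaces and commutativity -/

namespace IsMinimalDilation

open Filter Topology

variable {H : Type u} [NormedAddCommGroup H] [InnerProductSpace ℂ H] [CompleteSpace H]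
  {A : VonNeumannAlgebra H} {τ : A →CP A}
  {K : Type v} [NormedAddCommGroup K] [InnerProductSpace ℂ K] [CompleteSpace K]
  {V : H →ₗᵢ[ℂ] K} {B : VonNeumannAlgebra K} {θ : B →⋆ₐ[ℂ] B}
  (h : IsMinimalDilation τ V B θ)

/-- A peripheral eigenvector of `τ` lifts to an eigenvector of its dilation. -/
theorem exists_lift (hτ : τ 1 = 1) {c : ℂ} (hc : ‖c‖ = 1) {x : A} (hx : τ x = c • x) :
    ∃ z : B, θ z = c • z ∧ h.expect z = x := by
  have hc0 : c ≠ 0 := by rintro rfl; simp at hc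
  have hit : ∀ n, τ^[n] x = c ^ n • x := fun n => by
    induction n with
    | zero => simp
    | succ n ih => rw [Function.iterate_succ_apply', ih, map_smul, hx, smul_smul, pow_succ]
  -- Consistency: the compression by pₘ of c⁻⁽ᵐ⁺ᵏ⁾θᵐ⁺ᵏ(x) is c⁻⁽ᵐ⁺ᵏ⁾θᵐ(τᵏ(x)) = c⁻ᵐθᵐ(x).
  obtain ⟨z, hz⟩ := h.exists_proj_eq hτ (y := fun n => (c⁻¹) ^ n • θ.iter n (h.incl x))
    (C := ‖h.incl x‖) (fun n => by
      rw [norm_smul, norm_pow, norm_inv, hc, inv_one, one_pow, one_mul]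
      exact θ.norm_iter_le n _) (fun m n hmn => by
      obtain ⟨k, rfl⟩ := Nat.exists_eq_add_of_le hmn
      rw [mul_smul_comm, smul_mul_assoc, θ.iter_add, h.iter_incl_expect, h.expect_iter hτ,
        h.expect_incl, hit, h.incl_smul, map_smul, smul_smul, pow_add, mul_assoc, ← mul_pow,
        inv_mul_cancel₀ hc0, one_pow, mul_one])
  refine ⟨z, h.eq_of_forall_proj hτ fun n => ?_, ?_⟩
  · have h1 := congrArg θ (hz n)
    rw [map_mul, map_mul, map_smul] at h1
    refine Eq.trans h1 ?_
    rw [mul_smul_comm, smul_mul_assoc, hz, smul_smul, pow_succ', ← mul_assoc, mul_inv_cancel₀ hc0,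
      one_mul]
    rfl
  · have h1 := congrArg h.expect (hz 0)
    rw [pow_zero, one_smul] at h1
    exact (h.expect_incl_one_mul z).symm.trans (h1.trans (h.expect_incl x))

theorem expect_mem_span (hτ : τ 1 = 1) {z : B}
    (hz : z ∈ Submodule.span ℂ (peripheralEigenvectors (endoLinear θ))) :
    h.expect z ∈ Submodule.span ℂ (peripheralEigenvectors τ.toLinearMap) := by
  have h1 : Submodule.span ℂ (peripheralEigenvectors (endoLinear θ)) ≤
      (Submodule.span ℂ (peripheralEigenvectors τ.toLinearMap)).comap h.expect := by
    rw [Submodule.span_le]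
    rintro x ⟨c, hc, hx⟩
    have hx' : θ x = c • x := hx
    refine Submodule.subset_span ⟨c, hc, ?_⟩
    change τ (h.expect x) = c • h.expect x
    rw [← h.expect_endomorphism hτ, hx', map_smul]
  exact h1 hz

theorem continuous_expect : Continuous h.expect :=
  AddMonoidHomClass.continuous_of_bound h.expect 1 fun z => by
    rw [one_mul]; exact h.norm_expect_le z

theorem expect_mem_peripheralSpace (hτ : τ 1 = 1) {z : B} (hz : z ∈ peripheralAlgebra θ) :
    h.expect z ∈ peripheralSpace τ.toLinearMap := by
  exact map_mem_closure h.continuous_expect hz fun w hw => h.expect_mem_span hτ hw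

/-- Write z = θᵐ(w). Then ‖pₘzpₘ‖ ≤ ‖pwp‖, and pwp is the limit along the recurrence filter of
pθᵏ(w)p = τᵏ⁻ᵐ(pzp), of norm at most ‖pzp‖. -/
theorem norm_expect_of_mem_span (hτ : τ 1 = 1) {z : B}
    (hz : z ∈ Submodule.span ℂ (peripheralEigenvectors (endoLinear θ))) :
    ‖h.expect z‖ = ‖z‖ := by
  refine le_antisymm (h.norm_expect_le z) (h.norm_le_of_forall_proj hτ fun m => ?_)
  obtain ⟨w, hw, rfl⟩ := exists_iterate_eq_of_mem_span _ m hz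
  rw [StarAlgHom.endoLinear_pow, h.iter_incl_expect]
  refine (θ.norm_iter_le _ _).trans ((h.norm_incl_le _).trans ?_)
  obtain ⟨F, _, hF, hF1⟩ := exists_filter_tendsto_pow_one
  have h1 := tendsto_iterate_of_mem_span hF1 _ hw
  refine le_of_tendsto ((h.continuous_expect.tendsto _).comp h1).norm ?_
  filter_upwards [hF (eventually_ge_atTop m)] with k hk
  obtain ⟨j, rfl⟩ := Nat.exists_eq_add_of_le hk
  rw [Function.comp_apply, StarAlgHom.endoLinear_pow, add_comm, θ.iter_add, h.expect_iter hτ]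
  exact h.norm_iterate_le _ _

theorem norm_expect_of_mem (hτ : τ 1 = 1) {z : B} (hz : z ∈ peripheralAlgebra θ) :
    ‖h.expect z‖ = ‖z‖ := by
  exact closure_minimal (s := (Submodule.span ℂ (peripheralEigenvectors (endoLinear θ)) : Set B))
    (t := {z | ‖h.expect z‖ = ‖z‖}) (fun w hw => h.norm_expect_of_mem_span hτ hw)
    (isClosed_eq h.continuous_expect.norm continuous_norm) hz

/-- The compression of `𝒫(θ)` into `𝒫(τ)`. -/
def peripheralCompression (hτ : τ 1 = 1) :
    peripheralAlgebra θ →ₗᵢ[ℂ] peripheralSpace τ.toLinearMap where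
  toFun z := ⟨h.expect z, h.expect_mem_peripheralSpace hτ z.2⟩
  map_add' z w := Subtype.ext (map_add h.expect (z : B) w)
  map_smul' c z := Subtype.ext (map_smul h.expect c (z : B))
  norm_map' z := h.norm_expect_of_mem hτ z.2

/-- An isometry of a complete space has closed range, and this one contains every peripheral
eigenvector of τ by lifting. -/
theorem peripheralCompression_surjective (hτ : τ 1 = 1) :
    Function.Surjective (h.peripheralCompression hτ) := by
  let T := h.peripheralCompression hτ
  have : CompleteSpace (peripheralAlgebra θ) :=
    (StarSubalgebra.isClosed_topologicalClosure _).completeSpace_coe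
  have hclosed : IsClosed (Set.range T) := T.isometry.isClosedEmbedding.isClosed_range
  let R : Submodule ℂ A :=
    (LinearMap.range T.toLinearMap).map (peripheralSpace τ.toLinearMap).subtype
  have hR : IsClosed (R : Set A) := by
    have h1 : (R : Set A) = Subtype.val '' Set.range T := by
      ext; simp [R]
    rw [h1]
    exact (Submodule.isClosed_topologicalClosure _).isClosedEmbedding_subtypeVal.isClosedMap _
      hclosed
  have hle : peripheralSpace τ.toLinearMap ≤ R := by
    refine Submodule.topologicalClosure_minimal _ (Submodule.span_le.2 ?_) hR
    rintro x ⟨c, hc, hx⟩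
    obtain ⟨z, hz, rfl⟩ := h.exists_lift hτ hc hx
    have hz' : z ∈ peripheralAlgebra θ :=
      subset_closure (Submodule.subset_span (s := peripheralEigenvectors (endoLinear θ)) ⟨c, hc, hz⟩)
    exact ⟨T ⟨z, hz'⟩, ⟨⟨z, hz'⟩, rfl⟩, rfl⟩
  intro x
  obtain ⟨_, ⟨z, rfl⟩, hz⟩ := hle x.2
  exact ⟨z, Subtype.ext hz⟩

/-- Multiplication is jointly strongly continuous on bounded sequences. -/
theorem tendsto_proj_mul_proj_mul (hτ : τ 1 = 1) (z w : B) (ξ : K) :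
    Tendsto (fun n => (((h.proj n * z * h.proj n) * (h.proj n * w * h.proj n) : B) : K →L[ℂ] K) ξ)
      atTop (𝓝 (((z * w : B) : K →L[ℂ] K) ξ)) := by
  have h1 := h.tendsto_proj_mul_proj hτ z ((w : K →L[ℂ] K) ξ)
  have h2 : Tendsto (fun n => ((h.proj n * z * h.proj n : B) : K →L[ℂ] K)
      (((h.proj n * w * h.proj n : B) : K →L[ℂ] K) ξ - (w : K →L[ℂ] K) ξ)) atTop (𝓝 0) := by
    have h3 := (tendsto_iff_norm_sub_tendsto_zero.1
      (h.tendsto_proj_mul_proj hτ w ξ)).const_mul ‖z‖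
    rw [mul_zero] at h3
    refine squeeze_zero_norm (fun n => ContinuousLinearMap.le_of_opNorm_le _ ?_ _) h3
    calc ‖h.proj n * z * h.proj n‖ ≤ ‖h.proj n‖ * ‖z‖ * ‖h.proj n‖ :=
          (norm_mul_le _ _).trans (mul_le_mul_of_nonneg_right (norm_mul_le _ _) (norm_nonneg _))
      _ ≤ 1 * ‖z‖ * 1 := by gcongr <;> exact h.norm_proj_le n
      _ = ‖z‖ := by rw [one_mul, mul_one]
  have h4 := h2.add h1
  rw [zero_add] at h4
  refine h4.congr fun n => ?_
  rw [map_sub, sub_add_cancel]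
  rfl

/-- Both compressions by pₙ are images under θⁿ of elements of A, which commute; the strong limits
of the two products therefore agree. -/
theorem mul_comm_of_mem_span (h : IsMinimalDilation τ V B θ) (hτ : τ 1 = 1)
    (hA : ∀ a b : A, a * b = b * a) {z w : B}
    (hz : z ∈ Submodule.span ℂ (peripheralEigenvectors (endoLinear θ)))
    (hw : w ∈ Submodule.span ℂ (peripheralEigenvectors (endoLinear θ))) : z * w = w * z := by
  refine Subtype.ext (ContinuousLinearMap.ext fun ξ =>
    tendsto_nhds_unique (h.tendsto_proj_mul_proj_mul hτ z w ξ)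
      ((h.tendsto_proj_mul_proj_mul hτ w z ξ).congr fun n => ?_))
  obtain ⟨z', -, rfl⟩ := exists_iterate_eq_of_mem_span _ n hz
  obtain ⟨w', -, rfl⟩ := exists_iterate_eq_of_mem_span _ n hw
  simp only [StarAlgHom.endoLinear_pow, h.iter_incl_expect]
  rw [← map_mul, ← map_mul, ← h.incl_mul, ← h.incl_mul, hA]

theorem mul_comm_of_mem (h : IsMinimalDilation τ V B θ) (hτ : τ 1 = 1)
    (hA : ∀ a b : A, a * b = b * a) {z w : B}
    (hz : z ∈ peripheralAlgebra θ) (hw : w ∈ peripheralAlgebra θ) : z * w = w * z := by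
  have h1 : ∀ w ∈ Submodule.span ℂ (peripheralEigenvectors (endoLinear θ)), z * w = w * z :=
    fun w hw => closure_minimal
      (s := (Submodule.span ℂ (peripheralEigenvectors (endoLinear θ)) : Set B))
      (t := {z | z * w = w * z}) (fun z hz => h.mul_comm_of_mem_span hτ hA hz hw)
      (isClosed_eq (continuous_id.mul continuous_const) (continuous_const.mul continuous_id)) hz
  exact closure_minimal
    (s := (Submodule.span ℂ (peripheralEigenvectors (endoLinear θ)) : Set B))
    (t := {w | z * w = w * z}) h1
    (isClosed_eq (continuous_const.mul continuous_id) (continuous_id.mul continuous_const)) hw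

end IsMinimalDilation

end

theorem corollary2p6 {H : Type u} [NormedAddCommGroup H] [InnerProductSpace ℂ H]
    [CompleteSpace H] (A : VonNeumannAlgebra H) (τ : A →CP A) (hτ : IsNormalUCP τ)
    (hA : ∀ a b : A, a * b = b * a) :
    (∃ (K : Type u) (_ : NormedAddCommGroup K) (_ : InnerProductSpace ℂ K) (_ : CompleteSpace K)
      (V : H →ₗᵢ[ℂ] K) (B : VonNeumannAlgebra K) (θ : B →⋆ₐ[ℂ] B), IsMinimalDilation τ V B θ) ∧
    ∀ (K : Type v) [NormedAddCommGroup K] [InnerProductSpace ℂ K] [CompleteSpace K]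
      (V : H →ₗᵢ[ℂ] K) (B : VonNeumannAlgebra K) (θ : B →⋆ₐ[ℂ] B), IsMinimalDilation τ V B θ →
      ∃ T : peripheralAlgebra θ ≃ₗᵢ[ℂ] peripheralSpace τ.toLinearMap,
        IsCompression τ V B θ T ∧ ∀ x y, boundaryMul T x y = boundaryMul T y x := by
  refine ⟨exists_isMinimalDilation hτ, fun K _ _ _ V B θ h => ?_⟩
  refine ⟨LinearIsometryEquiv.ofSurjective (h.peripheralCompression hτ.map_one)
    (h.peripheralCompression_surjective hτ.map_one), fun z => ?_, fun x y => ?_⟩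
  · rw [LinearIsometryEquiv.coe_ofSurjective]
    rfl
  · rw [boundaryMul, boundaryMul]
    congr 1
    exact Subtype.ext (h.mul_comm_of_mem hτ.map_one hA (Subtype.prop _) (Subtype.prop _))
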